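/- Let $B$ be a separable Banach space, let $X_1,X_2,\dots$ be i.i.d. random variables on a probability space $(\Omega,\mathcal F,P)$ with values in a measurable space $\mathcal X$, let $m\ge 1$, and let $\Theta$ be a compact subset of a separable metric space. Let $\Phi:\Theta\times\mathcal X^m\to B$ be such that $\theta\mapsto\Phi(\theta,x)$ is continuous on $\Theta$ for every $x\in\mathcal X^m$, and $\Phi_\theta=\Phi(\theta,\cdot)$ is measurable and symmetric in its $m$ arguments for every $\theta\in\Theta$. For $x_1,\dots,x_n\in\mathcal X$ and $\varphi:\mathcal X^m\to B$ put $$U_n(\varphi;x_1,\dots,x_n)=\binom nm^{-1}\sum_{1\le i_1<\dots<i_m\le n}\varphi(x_{i_1},\dots,x_{i_m}),\qquad V_n(\varphi;x_1,\dots,x_n)=\frac1{n^m}\sum_{i_1=1}^n\cdots\sum_{i_m=1}^n\varphi(x_{i_1},\dots,x_{i_m}),$$ and write $U_n(\Phi_\theta)$, $V_n(\Phi_\theta)$ for their values at $(X_1,\dots,X_n)$. Write $U_n^*(\Phi_\theta)$, $V_n^*(\Phi_\theta)$ for their values at a bootstrap sample $(X_{n,1}^*,\dots,X_{n,n}^*)$,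 obtained for each $n$ by drawing $n$ times with replacement from $(X_1,\dots,X_n)$, that is, $X_{n,i}^*=X_{J_{n,i}}$ with $J_{n,1},\dots,J_{n,n}$ independent, uniformly distributed on $\{1,\dots,n\}$ and jointly independent of $(X_1,\dots,X_n)$. Consider the conditions (1) $E\big(\sup_{\theta\in\Theta}\|\Phi(\theta,X_1,\dots,X_m)\|_B\big)<\infty$; (2) for all positive integers $i_1,\dots,i_m$, $E\big(\sup_{\theta\in\Theta}\|\Phi(\theta,X_{i_1},\dots,X_{i_m})\|_B^{\#\{i_1,\dots,i_m\}/m}\big)<\infty$; (3) $B$ is of type 2: there is a constant $b$ such that $E\|\sum_{i=1}^n\xi_i\|_B^2\le b\sum_{i=1}^nE\|\xi_i\|_B^2$ for all $n\ge1$ and all i.i.d. $B$-valued random elements $\xi_1,\dots,\xi_n$ with $E\xi_1=0$ and $E\|\xi_1\|_B^2<\infty$. Under (1), and also under (2), the mean $g(\theta)=E(\Phi(\theta,X_1,\dots,X_m))$ exists as a Bochner integral for every $\theta\in\Theta$, and the following holds as $n\to\infty$. (a) If (1) holds, then $\sup_{\theta\in\Theta}\|U_n(\Phi_\theta)-g(\theta)\|_B\to0$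 almost surely. (b) If (2) holds, then $\sup_{\theta\in\Theta}\|V_n(\Phi_\theta)-g(\theta)\|_B\to0$ almost surely. (c) If (2) and (3) hold, then $\sup_{\theta\in\Theta}\|U_n^*(\Phi_\theta)-g(\theta)\|_B\to0$ in probability, and for every $\varepsilon>0$ $$P\Big(\sup_{\theta\in\Theta}\|U_n^*(\Phi_\theta)-g(\theta)\|_B>\varepsilon\,\Big|\,X_1,\dots,X_n\Big)\to0\quad\text{almost surely};$$ both statements also hold with $V_n^*$ in place of $U_n^*$. -/

import Mathlib

open MeasureTheory ProbabilityTheory Filter Topology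
open scoped ENNReal

namespace UVStat

universe u

variable {𝒳 : Type*} {B : Type*} [NormedAddCommGroup B] [NormedSpace ℝ B]

open scoped Classical in
/-- The U-statistic of degree `m` with kernel `φ`, evaluated at the sample `x` of size `n`:
the average of `φ (x_{i_1}, …, x_{i_m})` over all index tuples `i_1 < … < i_m`. -/
noncomputable def uStat {m n : ℕ} (φ : (Fin m → 𝒳) → B) (x : Fin n → 𝒳) : B :=
  ((n.choose m : ℕ) : ℝ)⁻¹ • ∑ i : Fin m → Fin n with StrictMono i, φ (fun j => x (i j))

/-- The V-statistic of degree `m` with kernel `φ`, evaluated at the sample `x` of size `n`: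
the average of `φ (x_{i_1}, …, x_{i_m})` over all index tuples. -/
noncomputable def vStat {m n : ℕ} (φ : (Fin m → 𝒳) → B) (x : Fin n → 𝒳) : B :=
  ((n : ℝ) ^ m)⁻¹ • ∑ i : Fin m → Fin n, φ (fun j => x (i j))

/-- The first `n` members of the sequence of observations, as a sample of size `n`. -/
def sample {Ω : Type*} (X : ℕ → Ω → 𝒳) (n : ℕ) (ω : Ω) : Fin n → 𝒳 := fun k => X k ω

/-- The bootstrap sample of size `n`: its `i`-th member is the observation with the random
index `J n i`. -/
def bootSample {Ω : Type*} (X : ℕ → Ω → 𝒳) (J : (n : ℕ) → Fin n → Ω → Fin n) (n : ℕ) (ω : Ω) :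
    Fin n → 𝒳 := fun i => X (J n i ω) ω

/-- The mean `E (Φ (θ, X_1, …, X_m))` as a Bochner integral. -/
noncomputable def kernelMean {Θ Ω : Type*} [MeasurableSpace Ω] {m : ℕ}
    (Φ : Θ → (Fin m → 𝒳) → B) (X : ℕ → Ω → 𝒳) (P : Measure Ω) (θ : Θ) : B :=
  ∫ ω, Φ θ (sample X m ω) ∂P

/-- Sampling with replacement: for every `n`, the `n` indices `J n 0, …, J n (n - 1)` are
independent and uniformly distributed on the `n` indices of the observations, and they are
jointly independent of the observations. -/
structure IsResampling {Ω : Type*} [MeasurableSpace Ω] [MeasurableSpace 𝒳]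
    (X : ℕ → Ω → 𝒳) (J : (n : ℕ) → Fin n → Ω → Fin n) (P : Measure Ω) : Prop where
  measurable : ∀ n i, Measurable (J n i)
  uniform : ∀ n (i k : Fin n), P {ω | J n i ω = k} = (n : ℝ≥0∞)⁻¹
  indep : ∀ n, iIndepFun (J n) P
  indep_sample : ∀ n, IndepFun (fun ω i => J n i ω) (sample X n) P

/-- The σ-algebra generated by the first `n` observations. -/
abbrev dataSigma {Ω : Type*} [MeasurableSpace 𝒳] (X : ℕ → Ω → 𝒳) (n : ℕ) : MeasurableSpace Ω :=
  MeasurableSpace.comap (sample X n) MeasurableSpace.pi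

/-- A Banach space of type 2: there is a constant `b` with
`E ‖∑ ξ_i‖ ^ 2 ≤ b * ∑ E ‖ξ_i‖ ^ 2` for all i.i.d. centred square integrable random elements
`ξ_1, …, ξ_n`, `n ≥ 1`. The inequality depends only on the law of `(ξ_1, …, ξ_n)` on `B ^ n`,
so probability spaces in the universe of `B` suffice. -/
def IsTypeTwo (B : Type u) [NormedAddCommGroup B] [NormedSpace ℝ B] [MeasurableSpace B] : Prop :=
  ∃ b : ℝ, ∀ (Ω : Type u) [MeasurableSpace Ω] (P : Measure Ω) [IsProbabilityMeasure P]
    (n : ℕ) (ξ : Fin n → Ω → B), 1 ≤ n →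
    (∀ i, Measurable (ξ i)) → iIndepFun ξ P → (∀ i j, IdentDistrib (ξ i) (ξ j) P P) →
    (∀ i, MemLp (ξ i) 2 P) → (∀ i, ∫ ω, ξ i ω ∂P = 0) →
    ∫ ω, ‖∑ i, ξ i ω‖ ^ 2 ∂P ≤ b * ∑ i, ∫ ω, ‖ξ i ω‖ ^ 2 ∂P

end UVStat

/-! Since `Θ` is compact, `Φ` amounts to one kernel with values in the separable Banach space `C(Θ,
B)`, whose norm is the supremum over `θ`. Everything thus reduces to laws of large numbers for a
single Banach-valued kernel on an i.i.d. sequence.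

U-statistics. Averages over injective tuples satisfy a weak type maximal inequality
(`mul_measure_exists_lt_injAvgE_le`), proved by exchangeability with time reversed. Hence the
integrable kernels obeying the strong law are closed in L¹ (`StrongLaw.of_approx`). Products of
bounded one-variable functions obey it by the classical strong law; a π-λ argument and L¹ density
give all integrable kernels (`strongLaw_of_integrable`).

V-statistics. They differ from U-statistics by a factor tending to 1 and by the tuples with
repetitions. A repetition pattern with `d < m` distinct entries contributes `n ^ (-m)` times a sum
over injective `d`-tuples, which vanishes by a Marcinkiewicz–Zygmund argument using only the moment
of order `d / m` (`tendsto_inv_pow_mul_sum_embedding`).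

Bootstrap. The conditional mean given the data is the finite average `bootAvg` over all `n ^ n`
index maps. The conditional mean of `‖V_n* - g‖` tends to zero: for indicators by a second moment
computation, since the square of a V-statistic is a V-statistic of a product kernel; for general
kernels by L¹ approximation with simple functions, because the conditional mean of a nonnegative
bootstrap V-statistic is bounded by the ordinary one plus its repeated part (`bootAvg_vAvg_le`,
`bootLaw_of_patternMoment`). Markov's inequality then gives conditional probabilities, and dominated
convergence the unconditional ones. -/

namespace UVStat

variable {𝒳 : Type*} {ι : Type*} [Fintype ι]

/-! ### Reindexing invariance of i.i.d. laws -/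

section Law

variable [MeasurableSpace 𝒳] (μ : Measure 𝒳) [IsProbabilityMeasure μ]

/-- The law of an i.i.d. sequence with marginal law `μ`. -/
noncomputable abbrev seqLaw : Measure (ℕ → 𝒳) := Measure.infinitePi fun _ : ℕ => μ

theorem map_infinitePi_comp_injective {α β : Type*} {f : α → β} (hf : f.Injective) :
    (Measure.infinitePi fun _ : β => μ).map (fun x a => x (f a)) =
      Measure.infinitePi fun _ : α => μ := by
  have h : iIndepFun (fun (i : β) (x : β → 𝒳) => x i) (Measure.infinitePi fun _ : β => μ) :=
    iIndepFun_infinitePi (X := fun _ => id) (fun _ => measurable_id)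
  have h' := h.precomp hf
  rw [iIndepFun_iff_map_fun_eq_infinitePi_map (fun a => measurable_pi_apply (f a))] at h'
  rw [h']
  congr 1
  funext a
  exact Measure.infinitePi_map_eval (fun _ : β => μ) (f a)

theorem measurePreserving_comp_injective {f : ι → ℕ} (hf : f.Injective) :
    MeasurePreserving (fun (x : ℕ → 𝒳) a => x (f a)) (seqLaw μ) (Measure.pi fun _ : ι => μ) :=
  ⟨by fun_prop, by rw [map_infinitePi_comp_injective μ hf, Measure.infinitePi_eq_pi]⟩

theorem measurePreserving_comp_perm (τ : Equiv.Perm ℕ) :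
    MeasurePreserving (fun (x : ℕ → 𝒳) a => x (τ a)) (seqLaw μ) (seqLaw μ) :=
  ⟨by fun_prop, map_infinitePi_comp_injective μ τ.injective⟩

end Law

/-! ### The maximal inequality for averages over injective tuples -/

section Maximal

theorem sum_embedding_comp_perm {M : Type*} [AddCommMonoid M] (h : (ι → 𝒳) → M) (x : ℕ → 𝒳)
    (τ : Equiv.Perm ℕ) (k : ℕ) (hτ : ∀ a, τ a < k ↔ a < k) :
    ∑ e : ι ↪ Fin k, h (fun a => x (τ (e a))) = ∑ e : ι ↪ Fin k, h (fun a => x (e a)) := by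
  let τk : Equiv.Perm (Fin k) := Fin.equivSubtype.symm.permCongr (τ.subtypePerm hτ)
  have hk : ∀ a : Fin k, ((τk a : Fin k) : ℕ) = τ a := fun a => rfl
  refine Fintype.sum_equiv (Equiv.embeddingCongr (Equiv.refl ι) τk) _ _ fun e => ?_
  congr 1

/-- The permutation moves only indices below `n`, so it preserves every later initial segment and
with it all averages of index at least `n`. -/
theorem exists_perm_extending {n : ℕ} (e e' : ι ↪ Fin n) :
    ∃ τ : Equiv.Perm ℕ, (∀ a, τ (e a) = e' a) ∧ ∀ k, n ≤ k → ∀ a, τ a < k ↔ a < k := by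
  classical
  let r : {y // y ∈ Set.range e} ≃ {y // y ∈ Set.range e'} :=
    (Equiv.ofInjective e e.injective).symm.trans (Equiv.ofInjective e' e'.injective)
  let σ : Equiv.Perm (Fin n) := r.extendSubtype
  have hσ : ∀ a, σ (e a) = e' a := fun a => by
    have : σ (e a) = r ⟨e a, Set.mem_range_self a⟩ :=
      Equiv.extendSubtype_apply_of_mem r (e a) (Set.mem_range_self a)
    rw [this]
    simp only [r, Equiv.trans_apply]
    have h2 : (⟨e a, Set.mem_range_self a⟩ : {y // y ∈ Set.range e}) =
      Equiv.ofInjective e e.injective a := rfl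
    rw [h2, Equiv.symm_apply_apply]
    rfl
  let τ : Equiv.Perm ℕ := σ.extendDomain Fin.equivSubtype
  have hlt : ∀ a : ℕ, a < n → τ a < n := fun a ha => by
    have := Equiv.Perm.extendDomain_apply_image σ Fin.equivSubtype ⟨a, ha⟩
    have h3 : τ a = σ ⟨a, ha⟩ := this
    rw [h3]
    exact (σ ⟨a, ha⟩).2
  have hge : ∀ a : ℕ, ¬ a < n → τ a = a := fun a ha =>
    Equiv.Perm.extendDomain_apply_not_subtype σ Fin.equivSubtype ha
  refine ⟨τ, fun a => ?_, fun k hk a => ?_⟩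
  · have := Equiv.Perm.extendDomain_apply_image σ Fin.equivSubtype (e a)
    exact this.trans (congrArg Fin.val (hσ a))
  · by_cases ha : a < n
    · exact ⟨fun _ => ha.trans_le hk, fun _ => (hlt a ha).trans_le hk⟩
    · rw [hge a ha]

/-- The average of a nonnegative kernel over all tuples of distinct indices below `n`. -/
noncomputable def injAvgE (h : (ι → 𝒳) → ℝ≥0∞) (n : ℕ) (x : ℕ → 𝒳) : ℝ≥0∞ :=
  (Fintype.card (ι ↪ Fin n) : ℝ≥0∞)⁻¹ * ∑ e : ι ↪ Fin n, h (fun a => x (e a))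

theorem injAvgE_comp_perm (h : (ι → 𝒳) → ℝ≥0∞) (x : ℕ → 𝒳)
    (τ : Equiv.Perm ℕ) (k : ℕ) (hτ : ∀ a, τ a < k ↔ a < k) :
    injAvgE h k (fun i => x (τ i)) = injAvgE h k x := by
  rw [injAvgE, injAvgE, sum_embedding_comp_perm h x τ k hτ]

variable [MeasurableSpace 𝒳] (μ : Measure 𝒳) [IsProbabilityMeasure μ]

theorem measurable_injAvgE {h : (ι → 𝒳) → ℝ≥0∞} (hh : Measurable h) (n : ℕ) :
    Measurable (injAvgE h n) := by
  unfold injAvgE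
  refine Measurable.const_mul (Finset.measurable_sum _ fun e _ => hh.comp ?_) _
  fun_prop

/-- Exchangeability: a permutation carrying `e` to `e'` preserves both the law and the event, so all
injective tuples have the same integral over `A`. -/
theorem setLIntegral_embedding_eq {h : (ι → 𝒳) → ℝ≥0∞} (hh : Measurable h) {n : ℕ}
    {A : Set (ℕ → 𝒳)} (hA : MeasurableSet A)
    (hinv : ∀ τ : Equiv.Perm ℕ, (∀ k, n ≤ k → ∀ a, τ a < k ↔ a < k) →
      ∀ x : ℕ → 𝒳, (fun i => x (τ i)) ∈ A ↔ x ∈ A) (e e' : ι ↪ Fin n) :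
    ∫⁻ x in A, h (fun a => x (e a)) ∂(seqLaw μ) = ∫⁻ x in A, h (fun a => x (e' a)) ∂(seqLaw μ) := by
  obtain ⟨τ, hτ, hτk⟩ := exists_perm_extending e e'
  have hm : Measurable fun x : ℕ → 𝒳 => h (fun a => x (e a)) := hh.comp (by fun_prop)
  rw [← (measurePreserving_comp_perm μ τ).setLIntegral_comp_preimage hA hm]
  have : (fun (x : ℕ → 𝒳) a => x (τ a)) ⁻¹' A = A := Set.ext fun x => hinv τ hτk x
  rw [this]
  simp only [hτ]

theorem mul_measure_le_setLIntegral {h : (ι → 𝒳) → ℝ≥0∞} (hh : Measurable h) {n : ℕ}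
    {A : Set (ℕ → 𝒳)} (hA : MeasurableSet A)
    (hinv : ∀ τ : Equiv.Perm ℕ, (∀ k, n ≤ k → ∀ a, τ a < k ↔ a < k) →
      ∀ x : ℕ → 𝒳, (fun i => x (τ i)) ∈ A ↔ x ∈ A) (c : ℝ≥0∞) (hc : ∀ x ∈ A, c ≤ injAvgE h n x)
    (e : ι ↪ Fin n) :
    c * seqLaw μ A ≤ ∫⁻ x in A, h (fun a => x (e a)) ∂(seqLaw μ) := by
  have hpos : (Fintype.card (ι ↪ Fin n) : ℝ≥0∞) ≠ 0 := by
    have : Nonempty (ι ↪ Fin n) := ⟨e⟩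
    exact_mod_cast Fintype.card_ne_zero
  calc c * seqLaw μ A = ∫⁻ _ in A, c ∂(seqLaw μ) := by rw [setLIntegral_const]
    _ ≤ ∫⁻ x in A, injAvgE h n x ∂(seqLaw μ) := setLIntegral_mono (measurable_injAvgE hh n) hc
    _ = (Fintype.card (ι ↪ Fin n) : ℝ≥0∞)⁻¹ *
          ∑ e' : ι ↪ Fin n, ∫⁻ x in A, h (fun a => x (e' a)) ∂(seqLaw μ) := by
        unfold injAvgE
        rw [lintegral_const_mul, lintegral_finsetSum]
        · intro e' _
          exact hh.comp (by fun_prop)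
        · exact Finset.measurable_sum _ fun e _ => hh.comp (by fun_prop)
    _ = ∫⁻ x in A, h (fun a => x (e a)) ∂(seqLaw μ) := by
        rw [Finset.sum_congr rfl fun e' _ => setLIntegral_embedding_eq μ hh hA hinv e' e,
          Finset.sum_const, Finset.card_univ, nsmul_eq_mul, ← mul_assoc,
          ENNReal.inv_mul_cancel hpos (ENNReal.natCast_ne_top _), one_mul]

/-- The weak type maximal inequality for U-statistics with a nonnegative kernel. -/
theorem mul_measure_exists_lt_injAvgE_le {h : (ι → 𝒳) → ℝ≥0∞} (hh : Measurable h) (c : ℝ≥0∞) :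
    c * seqLaw μ {x | ∃ n, Fintype.card ι ≤ n ∧ c < injAvgE h n x} ≤
      ∫⁻ y, h y ∂(Measure.pi fun _ : ι => μ) := by
  set m := Fintype.card ι with hmdef
  -- A reference tuple independent of `n`: the integrals over the disjoint events below then share
  -- one integrand and add up.
  let f0 : ι → ℕ := fun a => Fintype.equivFin ι a
  have hf0 : f0.Injective := Fin.val_injective.comp (Fintype.equivFin ι).injective
  have hf0lt : ∀ a, f0 a < m := fun a => (Fintype.equivFin ι a).2
  -- The event that `n` is the last index up to `N` at which the average exceeds `c`. Looking at the
  -- last rather than the first such index involves only averages of index at least `n`, which makes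
  -- the event invariant under permutations of the indices below `n`.
  let T : ℕ → ℕ → Set (ℕ → 𝒳) := fun N n =>
    {x | c < injAvgE h n x} ∩ ⋂ k ∈ Finset.Ioc n N, {x | injAvgE h k x ≤ c}
  have hT : ∀ N n, MeasurableSet (T N n) := fun N n =>
    (measurableSet_lt measurable_const (measurable_injAvgE hh n)).inter
      (Finset.measurableSet_biInter _ fun k _ =>
        measurableSet_le (measurable_injAvgE hh k) measurable_const)
  have hTinv : ∀ N n, ∀ τ : Equiv.Perm ℕ, (∀ k, n ≤ k → ∀ a, τ a < k ↔ a < k) →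
      ∀ x : ℕ → 𝒳, (fun i => x (τ i)) ∈ T N n ↔ x ∈ T N n := fun N n τ hτ x => by
    simp only [T, Set.mem_inter_iff, Set.mem_ofPred_eq, Set.mem_iInter, Finset.mem_Ioc]
    rw [injAvgE_comp_perm h x τ n (hτ n le_rfl)]
    refine and_congr_right fun _ => forall_congr' fun k => forall_congr' fun hk => ?_
    rw [injAvgE_comp_perm h x τ k (hτ k hk.1.le)]
  have hTdisj : ∀ N, Set.PairwiseDisjoint (↑(Finset.Icc m N)) (T N) := by
    intro N a ha b hb hab
    have key : ∀ a b, a < b → b ≤ N → Disjoint (T N a) (T N b) := fun a b hab hb => by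
      rw [Set.disjoint_left]
      rintro x ⟨-, hx⟩ ⟨hx', -⟩
      simp only [Set.mem_iInter, Finset.mem_Ioc] at hx
      exact (not_lt.2 (hx b ⟨hab, hb⟩) : ¬ c < injAvgE h b x) hx'
    simp only [Finset.coe_Icc, Set.mem_Icc] at ha hb
    rcases lt_or_gt_of_ne hab with h | h
    · exact key a b h hb.2
    · exact (key b a h ha.2).symm
  have hfin : ∀ N, c * seqLaw μ (⋃ n ∈ Finset.Icc m N, {x | c < injAvgE h n x}) ≤
      ∫⁻ y, h y ∂(Measure.pi fun _ : ι => μ) := fun N => by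
    have hsub : (⋃ n ∈ Finset.Icc m N, {x | c < injAvgE h n x}) ⊆ ⋃ n ∈ Finset.Icc m N, T N n := by
      intro x hx
      simp only [Set.mem_iUnion, exists_prop] at hx ⊢
      have hne : ((Finset.Icc m N).filter fun n => c < injAvgE h n x).Nonempty := by
        obtain ⟨n, hn, hx⟩ := hx
        exact ⟨n, Finset.mem_filter.2 ⟨hn, hx⟩⟩
      have hmem := Finset.mem_filter.1 (Finset.max'_mem _ hne)
      refine ⟨_, hmem.1, hmem.2, ?_⟩
      simp only [Set.mem_iInter, Finset.mem_Ioc, Set.mem_ofPred_eq]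
      intro k hk
      by_contra hcon
      have hkm : m ≤ k := (Finset.mem_Icc.1 hmem.1).1.trans hk.1.le
      have := Finset.le_max' ((Finset.Icc m N).filter fun n => c < injAvgE h n x) k
        (Finset.mem_filter.2 ⟨Finset.mem_Icc.2 ⟨hkm, hk.2⟩, lt_of_not_ge hcon⟩)
      exact absurd hk.1 (not_lt.2 this)
    calc c * seqLaw μ (⋃ n ∈ Finset.Icc m N, {x | c < injAvgE h n x})
        ≤ c * ∑ n ∈ Finset.Icc m N, seqLaw μ (T N n) := by
          gcongr
          exact (measure_mono hsub).trans (measure_biUnion_finset_le _ _)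
      _ = ∑ n ∈ Finset.Icc m N, c * seqLaw μ (T N n) := Finset.mul_sum _ _ _
      _ ≤ ∑ n ∈ Finset.Icc m N, ∫⁻ x in T N n, h (fun a => x (f0 a)) ∂(seqLaw μ) := by
          refine Finset.sum_le_sum fun n hn => ?_
          have hmn := (Finset.mem_Icc.1 hn).1
          let e : ι ↪ Fin n := ⟨fun a => ⟨f0 a, (hf0lt a).trans_le hmn⟩, fun a b hab =>
            hf0 (by simpa using hab)⟩
          exact mul_measure_le_setLIntegral μ hh (hT N n) (hTinv N n) c (fun x hx => hx.1.le) e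
      _ = ∫⁻ x in ⋃ n ∈ Finset.Icc m N, T N n, h (fun a => x (f0 a)) ∂(seqLaw μ) :=
          (lintegral_biUnion_finset (hTdisj N) (fun n _ => hT N n) _).symm
      _ ≤ ∫⁻ x, h (fun a => x (f0 a)) ∂(seqLaw μ) := setLIntegral_le_lintegral _ _
      _ = ∫⁻ y, h y ∂(Measure.pi fun _ : ι => μ) :=
          (measurePreserving_comp_injective μ hf0).lintegral_comp hh
  have hunion : {x : ℕ → 𝒳 | ∃ n, m ≤ n ∧ c < injAvgE h n x} =
      ⋃ N, ⋃ n ∈ Finset.Icc m N, {x | c < injAvgE h n x} := by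
    ext x
    simp only [Set.mem_ofPred_eq, Set.mem_iUnion, Finset.mem_Icc, exists_prop]
    exact ⟨fun ⟨n, hn, hx⟩ => ⟨n, n, ⟨hn, le_rfl⟩, hx⟩, fun ⟨_, n, hn, hx⟩ => ⟨n, hn.1, hx⟩⟩
  have hmono : Monotone fun N => ⋃ n ∈ Finset.Icc m N, {x : ℕ → 𝒳 | c < injAvgE h n x} :=
    fun N N' hN => Set.biUnion_subset_biUnion_left
      (Finset.coe_subset.2 (Finset.Icc_subset_Icc le_rfl hN))
  rw [hunion, hmono.measure_iUnion, ENNReal.mul_iSup]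
  exact iSup_le hfin

end Maximal

end UVStat

namespace UVStat

variable {𝒳 : Type*} {ι : Type*} [Fintype ι] {E : Type*} [NormedAddCommGroup E] [NormedSpace ℝ E]

/-! ### Algebra of averages over injective, arbitrary and repeated tuples -/

section Averages

/-- The average of a kernel over all tuples of distinct indices. -/
noncomputable def injAvg (φ : (ι → 𝒳) → E) {n : ℕ} (x : Fin n → 𝒳) : E :=
  (Fintype.card (ι ↪ Fin n) : ℝ)⁻¹ • ∑ e : ι ↪ Fin n, φ (fun a => x (e a))

open scoped Classical in
/-- The average of a kernel over all tuples of indices. -/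
noncomputable def vAvg (φ : (ι → 𝒳) → E) {n : ℕ} (x : Fin n → 𝒳) : E :=
  ((n : ℝ) ^ Fintype.card ι)⁻¹ • ∑ i : ι → Fin n, φ (fun a => x (i a))

open scoped Classical in
/-- The part of `vAvg` that comes from the tuples with repeated indices. -/
noncomputable def nonInjAvg (φ : (ι → 𝒳) → E) {n : ℕ} (x : Fin n → 𝒳) : E :=
  ((n : ℝ) ^ Fintype.card ι)⁻¹ •
    ∑ i : ι → Fin n with ¬ Function.Injective i, φ (fun a => x (i a))

variable (ι) in
/-- The proportion of tuples of distinct indices among all tuples of indices. -/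
noncomputable def injRatio (n : ℕ) : ℝ :=
  (Fintype.card (ι ↪ Fin n) : ℝ) / (n : ℝ) ^ Fintype.card ι

theorem sum_injective_eq_sum_embedding {M : Type*} [AddCommMonoid M] [DecidableEq ι] {n : ℕ}
    [DecidablePred fun i : ι → Fin n => Function.Injective i]
    (F : (ι → Fin n) → M) :
    ∑ i : ι → Fin n with Function.Injective i, F i = ∑ e : ι ↪ Fin n, F e := by
  rw [Finset.sum_subtype (p := Function.Injective) _ (by simp)]
  exact Fintype.sum_equiv (Equiv.subtypeInjectiveEquivEmbedding ι (Fin n)) _ _ fun _ => rfl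

theorem vAvg_eq (φ : (ι → 𝒳) → E) {n : ℕ} (x : Fin n → 𝒳) :
    vAvg φ x = injRatio ι n • injAvg φ x + nonInjAvg φ x := by
  classical
  unfold vAvg nonInjAvg injAvg injRatio
  rw [← Finset.sum_filter_add_sum_filter_not _ Function.Injective, smul_add,
    sum_injective_eq_sum_embedding (fun i : ι → Fin n => φ fun a => x (i a))]
  congr 1
  rw [smul_smul]
  -- Without injective tuples the sum is empty, and both sides vanish.
  rcases eq_or_ne (Fintype.card (ι ↪ Fin n)) 0 with h | h
  · have : IsEmpty (ι ↪ Fin n) := Fintype.card_eq_zero_iff.1 h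
    simp
  · congr 1
    have : (Fintype.card (ι ↪ Fin n) : ℝ) ≠ 0 := Nat.cast_ne_zero.2 h
    field_simp

theorem vAvg_const (c : E) {n : ℕ} (hn : n ≠ 0) (x : Fin n → 𝒳) :
    vAvg (fun _ : ι → 𝒳 => c) x = c := by
  classical
  have : (n : ℝ) ≠ 0 := Nat.cast_ne_zero.2 hn
  simp only [vAvg, Finset.sum_const, Finset.card_univ, Fintype.card_fun, Fintype.card_fin]
  rw [← Nat.cast_smul_eq_nsmul ℝ, smul_smul, Nat.cast_pow, inv_mul_cancel₀ (by positivity),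
    one_smul]

theorem card_embedding_ne_zero {n : ℕ} (hn : Fintype.card ι ≤ n) :
    Fintype.card (ι ↪ Fin n) ≠ 0 := by
  rw [Fintype.card_embedding_eq, Fintype.card_fin]
  exact (Nat.descFactorial_pos.2 hn).ne'

theorem injAvg_const (c : E) {n : ℕ} (hn : Fintype.card ι ≤ n) (x : Fin n → 𝒳) :
    injAvg (fun _ : ι → 𝒳 => c) x = c := by
  have : (Fintype.card (ι ↪ Fin n) : ℝ) ≠ 0 := Nat.cast_ne_zero.2 (card_embedding_ne_zero hn)
  simp only [injAvg, Finset.sum_const, Finset.card_univ]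
  rw [← Nat.cast_smul_eq_nsmul ℝ, smul_smul, inv_mul_cancel₀ this, one_smul]

theorem injAvg_add (φ ψ : (ι → 𝒳) → E) {n : ℕ} (x : Fin n → 𝒳) :
    injAvg (φ + ψ) x = injAvg φ x + injAvg ψ x := by
  simp [injAvg, Finset.sum_add_distrib]

theorem injAvg_smul_const (f : (ι → 𝒳) → ℝ) (c : E) {n : ℕ} (x : Fin n → 𝒳) :
    injAvg (fun y => f y • c) x = injAvg f x • c := by
  simp [injAvg, ← Finset.sum_smul, smul_smul]

theorem nonInjAvg_mono {f g : (ι → 𝒳) → ℝ} (h : ∀ y, f y ≤ g y) {n : ℕ} (x : Fin n → 𝒳) :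
    nonInjAvg f x ≤ nonInjAvg g x := by
  simp only [nonInjAvg, smul_eq_mul]
  gcongr
  exact h _

theorem nonInjAvg_nonneg {f : (ι → 𝒳) → ℝ} (h : ∀ y, 0 ≤ f y) {n : ℕ} (x : Fin n → 𝒳) :
    0 ≤ nonInjAvg f x := by
  simp only [nonInjAvg, smul_eq_mul]
  exact mul_nonneg (by positivity) (Finset.sum_nonneg fun i _ => h _)

theorem nonInjAvg_add (φ ψ : (ι → 𝒳) → E) {n : ℕ} (x : Fin n → 𝒳) :
    nonInjAvg (φ + ψ) x = nonInjAvg φ x + nonInjAvg ψ x := by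
  simp [nonInjAvg, Finset.sum_add_distrib]

theorem norm_nonInjAvg_le (φ : (ι → 𝒳) → E) {n : ℕ} (x : Fin n → 𝒳) :
    ‖nonInjAvg φ x‖ ≤ nonInjAvg (fun y => ‖φ y‖) x := by
  simp only [nonInjAvg, smul_eq_mul, norm_smul]
  refine mul_le_mul (le_of_eq (Real.norm_of_nonneg (by positivity))) (norm_sum_le _ _)
    (norm_nonneg _) (by positivity)

theorem norm_vAvg_le (φ : (ι → 𝒳) → E) {n : ℕ} (x : Fin n → 𝒳) :
    ‖vAvg φ x‖ ≤ vAvg (fun y => ‖φ y‖) x := by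
  simp only [vAvg, smul_eq_mul, norm_smul]
  refine mul_le_mul (le_of_eq (Real.norm_of_nonneg (by positivity))) (norm_sum_le _ _)
    (norm_nonneg _) (by positivity)

theorem injRatio_pos {n : ℕ} (hn : Fintype.card ι ≤ n) (hn0 : n ≠ 0) : 0 < injRatio ι n := by
  have h1 : 0 < Fintype.card (ι ↪ Fin n) := Nat.pos_of_ne_zero (card_embedding_ne_zero hn)
  have h2 : 0 < n := Nat.pos_of_ne_zero hn0
  unfold injRatio; positivity

theorem injRatio_le_one (n : ℕ) : injRatio ι n ≤ 1 := by
  refine div_le_one_of_le₀ ?_ (by positivity)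
  rw [Fintype.card_embedding_eq, Fintype.card_fin]
  exact_mod_cast Nat.descFactorial_le_pow _ _

variable (ι) in
theorem tendsto_injRatio : Tendsto (injRatio ι) atTop (𝓝 1) := by
  have h := (isEquivalent_descFactorial (Fintype.card ι))
  rw [Asymptotics.isEquivalent_iff_tendsto_one] at h
  · refine h.congr fun n => ?_
    simp [injRatio, Fintype.card_embedding_eq]
  · filter_upwards [eventually_gt_atTop 0] with n hn
    positivity

theorem nonInjAvg_const (c : ℝ) {n : ℕ} (hn : n ≠ 0) (hn' : Fintype.card ι ≤ n) (x : Fin n → 𝒳) :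
    nonInjAvg (fun _ : ι → 𝒳 => c) x = c * (1 - injRatio ι n) := by
  have := vAvg_eq (fun _ : ι → 𝒳 => c) x
  rw [vAvg_const c hn, injAvg_const c hn', smul_eq_mul] at this
  linarith

theorem tendsto_nonInjAvg_const (c : ℝ) (x : ∀ n, Fin n → 𝒳) :
    Tendsto (fun n => nonInjAvg (fun _ : ι → 𝒳 => c) (x n)) atTop (𝓝 0) := by
  have h : Tendsto (fun n => c * (1 - injRatio ι n)) atTop (𝓝 (c * (1 - 1))) :=
    ((tendsto_injRatio ι).const_sub 1).const_mul c
  rw [sub_self, mul_zero] at h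
  refine h.congr' ?_
  filter_upwards [eventually_gt_atTop 0, eventually_ge_atTop (Fintype.card ι)] with n h0 hn
  rw [nonInjAvg_const c h0.ne' hn]

theorem tendsto_nonInjAvg_of_bounded {φ : (ι → 𝒳) → E} {C : ℝ} (hφ : ∀ y, ‖φ y‖ ≤ C)
    (x : ∀ n, Fin n → 𝒳) : Tendsto (fun n => nonInjAvg φ (x n)) atTop (𝓝 0) :=
  squeeze_zero_norm (fun _ => (norm_nonInjAvg_le _ _).trans (nonInjAvg_mono hφ _))
    (tendsto_nonInjAvg_const C x)

theorem tendsto_injAvg_of_tendsto_vAvg {φ : (ι → 𝒳) → E} {x : ∀ n, Fin n → 𝒳} {g : E}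
    (hN : Tendsto (fun n => nonInjAvg φ (x n)) atTop (𝓝 0))
    (hV : Tendsto (fun n => vAvg φ (x n)) atTop (𝓝 g)) :
    Tendsto (fun n => injAvg φ (x n)) atTop (𝓝 g) := by
  have h := ((tendsto_injRatio ι).inv₀ one_ne_zero).smul (hV.sub hN)
  rw [inv_one, sub_zero, one_smul] at h
  refine h.congr' ?_
  filter_upwards [eventually_gt_atTop 0, eventually_ge_atTop (Fintype.card ι)] with n h0 hn
  rw [vAvg_eq, add_sub_cancel_right, smul_smul, inv_mul_cancel₀ (injRatio_pos hn h0.ne').ne',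
    one_smul]

theorem tendsto_vAvg_of_tendsto_injAvg {φ : (ι → 𝒳) → E} {x : ∀ n, Fin n → 𝒳} {g : E}
    (hN : Tendsto (fun n => nonInjAvg φ (x n)) atTop (𝓝 0))
    (hU : Tendsto (fun n => injAvg φ (x n)) atTop (𝓝 g)) :
    Tendsto (fun n => vAvg φ (x n)) atTop (𝓝 g) := by
  have h := ((tendsto_injRatio ι).smul hU).add hN
  rw [add_zero, one_smul] at h
  exact h.congr fun n => (vAvg_eq φ (x n)).symm

/-- Summing over all tuples makes the sum factor into empirical means; this is how the classical
strong law enters. -/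
theorem vAvg_prod (f : ι → 𝒳 → ℝ) {n : ℕ} (x : Fin n → 𝒳) :
    vAvg (fun y : ι → 𝒳 => ∏ a, f a (y a)) x = ∏ a, ((∑ k, f a (x k)) / n) := by
  classical
  rw [Finset.prod_div_distrib, Finset.prod_univ_sum, Finset.prod_const, Finset.card_univ,
    Fintype.piFinset_univ]
  simp only [vAvg, smul_eq_mul]
  rw [div_eq_inv_mul]

theorem enorm_injAvg_sub_le (φ ψ : (ι → 𝒳) → E) (n : ℕ) (x : ℕ → 𝒳) :
    ‖injAvg φ (fun k : Fin n => x k) - injAvg ψ (fun k : Fin n => x k)‖ₑ ≤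
      injAvgE (fun y => ‖φ y - ψ y‖ₑ) n x := by
  simp only [injAvg, injAvgE, ← smul_sub, ← Finset.sum_sub_distrib, enorm_smul]
  rcases eq_or_ne (Fintype.card (ι ↪ Fin n)) 0 with h | h
  · have : IsEmpty (ι ↪ Fin n) := Fintype.card_eq_zero_iff.1 h
    simp
  · gcongr
    · rw [enorm_inv (Nat.cast_ne_zero.2 h)]
      simp
    · exact enorm_sum_le _ _

end Averages

/-! ### The strong law for U-statistics -/

section StrongLaw

variable [MeasurableSpace 𝒳] (μ : Measure 𝒳)

/-- The strong law of large numbers for the U-statistics with kernel `φ`. -/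
def StrongLaw (φ : (ι → 𝒳) → E) : Prop :=
  ∀ᵐ x ∂(seqLaw μ), Tendsto (fun n => injAvg φ (fun k : Fin n => x k)) atTop
    (𝓝 (∫ y, φ y ∂(Measure.pi fun _ : ι => μ)))

theorem StrongLaw.add {φ ψ : (ι → 𝒳) → E} (hφ : Integrable φ (Measure.pi fun _ : ι => μ))
    (hψ : Integrable ψ (Measure.pi fun _ : ι => μ)) (h1 : StrongLaw μ φ) (h2 : StrongLaw μ ψ) :
    StrongLaw μ (φ + ψ) := by
  filter_upwards [h1, h2] with x hx1 hx2
  simp only [injAvg_add, Pi.add_apply]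
  rw [integral_add hφ hψ]
  exact hx1.add hx2

variable [IsProbabilityMeasure μ]

/-- The maximal inequality applied to the error kernels, followed by Borel–Cantelli, bounds the
error averages uniformly in `n` for all late approximants. -/
theorem StrongLaw.of_approx {φ : (ι → 𝒳) → E} (hφ : Integrable φ (Measure.pi fun _ : ι => μ))
    (H : ∀ ε : ℝ≥0∞, 0 < ε → ∃ ψ : (ι → 𝒳) → E, Integrable ψ (Measure.pi fun _ : ι => μ) ∧
      StrongLaw μ ψ ∧ ∫⁻ y, ‖φ y - ψ y‖ₑ ∂(Measure.pi fun _ : ι => μ) ≤ ε) :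
    StrongLaw μ φ := by
  -- The L¹ error is `4 ^ (-k)`: dividing by the threshold `2 ^ (-k)` leaves the summable bound `2 ^
  -- (-k)` for the bad events.
  have hpow : ∀ k : ℕ, (0 : ℝ≥0∞) < ((2 : ℝ≥0∞)⁻¹ ^ k) * ((2 : ℝ≥0∞)⁻¹ ^ k) := fun k => by
    have : (0 : ℝ≥0∞) < 2⁻¹ ^ k := ENNReal.pow_pos (by simp) k
    exact ENNReal.mul_pos this.ne' this.ne'
  choose ψ hψi hψ hψε using fun k : ℕ => H _ (hpow k)
  set π := Measure.pi fun _ : ι => μ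
  -- replace the error kernels by measurable ones
  have hmeas : ∀ k, ∃ h : (ι → 𝒳) → ℝ≥0∞, Measurable h ∧ (∀ y, ‖φ y - ψ k y‖ₑ ≤ h y) ∧
      ∫⁻ y, h y ∂π = ∫⁻ y, ‖φ y - ψ k y‖ₑ ∂π := fun k => by
    have hae := (hφ.sub (hψi k)).aestronglyMeasurable.enorm
    let N := toMeasurable π {y | ‖φ y - ψ k y‖ₑ ≠ hae.mk _ y}
    have hN : π N = 0 := (measure_toMeasurable _).trans hae.ae_eq_mk
    -- The value `∞` on the null set keeps the domination true at every point, so it passes to the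
    -- averages without a null-set argument.
    refine ⟨N.indicator (fun _ => ∞) + hae.mk _, (measurable_const.indicator
      (measurableSet_toMeasurable _ _)).add hae.measurable_mk, fun y => ?_, ?_⟩
    · by_cases hy : y ∈ N
      · simp [hy]
      · have : ‖φ y - ψ k y‖ₑ = hae.mk _ y := by
          by_contra hne
          exact hy (subset_toMeasurable _ _ hne)
        rw [this]
        exact le_add_self
    · refine lintegral_congr_ae ?_
      filter_upwards [measure_eq_zero_iff_ae_notMem.1 hN, hae.ae_eq_mk] with y hy hy'
      simp only [Pi.add_apply, Set.indicator_of_notMem hy, zero_add]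
      exact hy'.symm
  choose h hh hle heq using hmeas
  let bad : ℕ → Set (ℕ → 𝒳) := fun k =>
    {x | ∃ n, Fintype.card ι ≤ n ∧ (2 : ℝ≥0∞)⁻¹ ^ k < injAvgE (h k) n x}
  have hbad : ∀ k, seqLaw μ (bad k) ≤ (2 : ℝ≥0∞)⁻¹ ^ k := fun k => by
    have h1 := (mul_measure_exists_lt_injAvgE_le μ (hh k) ((2 : ℝ≥0∞)⁻¹ ^ k)).trans
      ((heq k).le.trans (hψε k))
    exact (ENNReal.mul_le_mul_iff_right (by simp) (by simp)).1 h1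
  have hsum : ∑' k, seqLaw μ (bad k) ≠ ∞ := by
    refine ne_top_of_le_ne_top ?_ (ENNReal.tsum_le_tsum hbad)
    rw [ENNReal.tsum_geometric]
    simp
  have hint : Tendsto (fun k => ∫ y, ψ k y ∂π) atTop (𝓝 (∫ y, φ y ∂π)) := by
    refine tendsto_integral_of_L1 φ hφ.aestronglyMeasurable (Eventually.of_forall hψi) ?_
    refine tendsto_of_tendsto_of_tendsto_of_le_of_le tendsto_const_nhds
      (ENNReal.tendsto_pow_atTop_nhds_zero_of_lt_one (r := 2⁻¹) (by simp)) (fun _ => zero_le)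
      fun k => ?_
    calc ∫⁻ y, ‖ψ k y - φ y‖ₑ ∂π = ∫⁻ y, ‖φ y - ψ k y‖ₑ ∂π := by
          simp only [enorm_sub_rev]
      _ ≤ _ := hψε k
      _ ≤ _ := mul_le_of_le_one_left' (pow_le_one₀ zero_le (by simp))
  filter_upwards [ae_eventually_notMem hsum, ae_all_iff.2 hψ] with x hx hxψ
  rw [EMetric.tendsto_atTop]
  intro ε hε
  have hε3 : 0 < ε / 3 := by simpa using hε.ne'
  have e1 := (ENNReal.tendsto_pow_atTop_nhds_zero_of_lt_one (r := (2 : ℝ≥0∞)⁻¹)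
    (by simp)).eventually (gt_mem_nhds hε3)
  have e2 := (EMetric.tendsto_nhds.1 hint) _ hε3
  obtain ⟨k, hk, hk1, hk2⟩ := (hx.and (e1.and e2)).exists
  obtain ⟨N, hN⟩ := (EMetric.tendsto_atTop.1 (hxψ k)) _ hε3
  refine ⟨max N (Fintype.card ι), fun n hn => ?_⟩
  have hk' : injAvgE (h k) n x ≤ (2 : ℝ≥0∞)⁻¹ ^ k := by
    by_contra hcon
    exact hk ⟨n, (le_max_right _ _).trans hn, lt_of_not_ge hcon⟩
  have h1 : edist (injAvg φ fun k : Fin n => x k) (injAvg (ψ k) fun k : Fin n => x k) < ε / 3 := by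
    rw [edist_eq_enorm_sub]
    refine (enorm_injAvg_sub_le φ (ψ k) n x).trans_lt (lt_of_le_of_lt ?_ (hk'.trans_lt hk1))
    unfold injAvgE
    gcongr
    exact hle k _
  calc edist (injAvg φ fun k : Fin n => x k) (∫ y, φ y ∂π)
      ≤ edist (injAvg φ fun k : Fin n => x k) (injAvg (ψ k) fun k : Fin n => x k) +
        edist (injAvg (ψ k) fun k : Fin n => x k) (∫ y, ψ k y ∂π) +
        edist (∫ y, ψ k y ∂π) (∫ y, φ y ∂π) := edist_triangle4 _ _ _ _
    _ < ε / 3 + ε / 3 + ε / 3 :=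
        ENNReal.add_lt_add (ENNReal.add_lt_add h1 (hN n ((le_max_left _ _).trans hn))) hk2
    _ = ε := ENNReal.add_thirds ε

theorem StrongLaw.const (c : E) [CompleteSpace E] : StrongLaw μ (fun _ : ι → 𝒳 => c) := by
  refine ae_of_all _ fun x => ?_
  rw [integral_const]
  simp only [probReal_univ, one_smul]
  refine tendsto_const_nhds.congr' ?_
  filter_upwards [eventually_ge_atTop (Fintype.card ι)] with n hn
  rw [injAvg_const c hn]

/-- The V-average is a product of empirical means, each converging by the classical strong law;
boundedness makes the repeated tuples negligible. -/
theorem strongLaw_prod {f : ι → 𝒳 → ℝ} (hf : ∀ a, Measurable (f a)) {C : ℝ}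
    (hC : ∀ a y, |f a y| ≤ C) : StrongLaw μ (fun y : ι → 𝒳 => ∏ a, f a (y a)) := by
  have hlaw : ∀ a, ∀ᵐ x ∂(seqLaw μ),
      Tendsto (fun n : ℕ => (∑ k : Fin n, f a (x k)) / n) atTop (𝓝 (∫ y, f a y ∂μ)) := fun a => by
    have hid : ∀ i, (seqLaw μ).map (fun x => x i) = μ := fun i =>
      Measure.infinitePi_map_eval (fun _ : ℕ => μ) i
    have hind : iIndepFun (fun (i : ℕ) (x : ℕ → 𝒳) => f a (x i)) (seqLaw μ) :=
      iIndepFun_infinitePi (X := fun _ => f a) (fun _ => hf a)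
    have hm : ∀ i, Measurable fun x : ℕ → 𝒳 => f a (x i) := fun i =>
      (hf a).comp (measurable_pi_apply i)
    have h := strong_law_ae_real (μ := seqLaw μ) (fun (i : ℕ) (x : ℕ → 𝒳) => f a (x i))
      (Integrable.of_bound (hm 0).aestronglyMeasurable C (ae_of_all _ fun x => hC a _))
      (fun i j hij => hind.indepFun hij) (fun i => by
        refine ⟨(hm i).aemeasurable, (hm 0).aemeasurable, ?_⟩
        have hmap : ∀ j, (seqLaw μ).map (fun x => f a (x j)) = μ.map (f a) := fun j => by
          exact (Measure.map_map (hf a) (measurable_pi_apply j)).symm.trans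
            (congrArg (Measure.map (f a)) (hid j))
        rw [hmap, hmap])
    have hint : ∫ x, f a (x 0) ∂(seqLaw μ) = ∫ y, f a y ∂μ := by
      conv_rhs => rw [← hid 0]
      rw [integral_map (measurable_pi_apply 0).aemeasurable (hf a).aestronglyMeasurable]
    rw [hint] at h
    filter_upwards [h] with x hx
    simpa only [Finset.sum_range] using hx
  filter_upwards [ae_all_iff.2 hlaw] with x hx
  rw [integral_fintype_prod_eq_prod (fun a => f a)]
  refine tendsto_injAvg_of_tendsto_vAvg
    (tendsto_nonInjAvg_of_bounded (C := C ^ Fintype.card ι) (fun y => ?_) _) ?_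
  · rw [Real.norm_eq_abs, Finset.abs_prod]
    exact (Finset.prod_le_prod (fun a _ => abs_nonneg _) fun a _ => hC a _).trans (by simp)
  · simp only [vAvg_prod]
    exact tendsto_finsetProd _ fun a _ => hx a

theorem strongLaw_indicator_one {s : Set (ι → 𝒳)} (hs : MeasurableSet s) :
    StrongLaw μ (s.indicator fun _ => (1 : ℝ)) := by
  set π := Measure.pi fun _ : ι => μ
  have hi : ∀ t : Set (ι → 𝒳), MeasurableSet t → Integrable (t.indicator fun _ => (1 : ℝ)) π :=
    fun t ht => (integrable_const (1 : ℝ)).indicator ht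
  refine MeasurableSpace.induction_on_inter
    (C := fun s _ => StrongLaw μ (s.indicator fun _ => (1 : ℝ)))
    generateFrom_pi.symm isPiSystem_pi ?_ ?_ ?_ ?_ s hs
  · simpa using StrongLaw.const μ (ι := ι) (0 : ℝ)
  · rintro t ⟨A, hA, rfl⟩
    have hA' : ∀ a, MeasurableSet (A a) := fun a => hA a trivial
    have h := strongLaw_prod μ (f := fun a => (A a).indicator fun _ => (1 : ℝ))
      (fun a => measurable_const.indicator (hA' a)) (C := 1) (fun a y => by
        by_cases hy : y ∈ A a <;> simp [hy])
    convert h using 1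
    funext y
    by_cases hy : y ∈ Set.univ.pi A
    · rw [Set.indicator_of_mem hy]
      refine (Finset.prod_eq_one fun a _ => Set.indicator_of_mem (hy a trivial) _).symm
    · rw [Set.indicator_of_notMem hy]
      simp only [Set.mem_univ_pi, not_forall] at hy
      obtain ⟨a, ha⟩ := hy
      exact (Finset.prod_eq_zero (Finset.mem_univ a) (Set.indicator_of_notMem ha _)).symm
  · intro t ht ih
    have h := (StrongLaw.const μ (ι := ι) (1 : ℝ)).add μ (integrable_const _) (hi t ht).neg (by
      filter_upwards [ih] with x hx
      simp only [Pi.neg_apply, integral_neg]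
      refine hx.neg.congr fun n => ?_
      simp [injAvg])
    convert h using 1
    funext y
    by_cases hy : y ∈ t <;> simp [hy]
  -- Finite partial unions follow by additivity, and the mass of the remainder tends to zero, so
  -- `StrongLaw.of_approx` applies.
  · intro A hd hA ih
    have hpart : ∀ K, StrongLaw μ ((⋃ k ∈ Finset.range K, A k).indicator fun _ => (1 : ℝ)) := by
      intro K
      induction K with
      | zero => simpa using StrongLaw.const μ (ι := ι) (0 : ℝ)
      | succ K IH =>
        have h := IH.add μ (hi _ (Finset.measurableSet_biUnion _ fun k _ => hA k)) (hi _ (hA K))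
          (ih K)
        convert h using 1
        rw [Finset.range_add_one, Finset.set_biUnion_insert, Set.union_comm,
          Set.indicator_union_of_disjoint]
        · rfl
        · refine Set.disjoint_iUnion₂_left.2 fun k hk => hd ?_
          exact (Finset.mem_range.1 hk).ne
    refine StrongLaw.of_approx μ (hi _ (MeasurableSet.iUnion hA)) fun ε hε => ?_
    have htend : Tendsto (fun K => π ((⋃ k, A k) \ ⋃ k ∈ Finset.range K, A k)) atTop (𝓝 0) := by
      have h := tendsto_measure_iInter_atTop (μ := π)
        (s := fun K => (⋃ k, A k) \ ⋃ k ∈ Finset.range K, A k)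
        (fun K => ((MeasurableSet.iUnion hA).diff
          (Finset.measurableSet_biUnion _ fun k _ => hA k)).nullMeasurableSet)
        (fun K K' hK => Set.sdiff_subset_sdiff_right (Set.biUnion_subset_biUnion_left
          (Finset.coe_subset.2 (Finset.range_subset_range.2 hK)))) ⟨0, measure_ne_top _ _⟩
      have hempty : (⋂ K, (⋃ k, A k) \ ⋃ k ∈ Finset.range K, A k) = ∅ := by
        refine Set.eq_empty_of_forall_notMem fun y hy => ?_
        rw [Set.mem_iInter] at hy
        obtain ⟨k, hk⟩ := Set.mem_iUnion.1 (hy 0).1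
        exact (hy (k + 1)).2 (Set.mem_biUnion (by simp) hk)
      rwa [hempty, measure_empty] at h
    obtain ⟨K, hK⟩ := (htend.eventually (gt_mem_nhds hε)).exists
    refine ⟨_, hi _ (Finset.measurableSet_biUnion _ fun k _ => hA k), hpart K, ?_⟩
    refine le_trans (le_of_eq ?_) hK.le
    rw [← lintegral_indicator_one ((MeasurableSet.iUnion hA).diff
          (Finset.measurableSet_biUnion _ fun k _ => hA k))]
    refine lintegral_congr fun y => ?_
    have hsub : (⋃ k ∈ Finset.range K, A k) ⊆ ⋃ k, A k :=
      Set.iUnion₂_subset fun k _ => Set.subset_iUnion A k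
    rw [← Pi.sub_apply, ← Set.indicator_sdiff hsub]
    by_cases hy : y ∈ (⋃ k, A k) \ ⋃ k ∈ Finset.range K, A k
    · rw [Set.indicator_of_mem hy, Set.indicator_of_mem hy]
      simp
    · rw [Set.indicator_of_notMem hy, Set.indicator_of_notMem hy]
      simp

/-- The strong law of large numbers for U-statistics with an integrable kernel. -/
theorem strongLaw_of_integrable [CompleteSpace E] {φ : (ι → 𝒳) → E}
    (hφ : Integrable φ (Measure.pi fun _ : ι => μ)) : StrongLaw μ φ := by
  refine Integrable.induction (StrongLaw μ) ?_ ?_ ?_ ?_ hφ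
  · intro c s hs _
    have h := strongLaw_indicator_one μ hs
    have heq : (s.indicator fun _ => c) = fun y => s.indicator (fun _ => (1 : ℝ)) y • c := by
      funext y
      by_cases hy : y ∈ s <;> simp [hy]
    rw [heq]
    filter_upwards [h] with x hx
    rw [integral_smul_const]
    simp only [injAvg_smul_const]
    exact hx.smul_const c
  · intro f g _ hf hg h1 h2
    exact h1.add μ hf hg h2
  · rw [← isSeqClosed_iff_isClosed]
    intro f g hf hfg
    refine StrongLaw.of_approx μ (L1.integrable_coeFn g) fun ε hε => ?_
    obtain ⟨k, hk⟩ := ((EMetric.tendsto_nhds.1 hfg) ε hε).exists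
    refine ⟨f k, L1.integrable_coeFn _, hf k, le_trans (le_of_eq ?_) hk.le⟩
    rw [edist_comm, L1.edist_def]
    simp only [edist_eq_enorm_sub]
  -- Almost everywhere equality is L¹ distance zero, so `f` itself serves as the approximant.
  · intro f g hfg hf h
    refine StrongLaw.of_approx μ (hf.congr hfg) fun ε hε => ⟨f, hf, h, ?_⟩
    refine le_trans (le_of_eq ?_) zero_le
    rw [← lintegral_zero]
    refine lintegral_congr_ae ?_
    filter_upwards [hfg] with y hy
    simp [hy]

end StrongLaw

end UVStat

namespace UVStat

variable {𝒳 : Type*} {ι : Type*} [Fintype ι] {E : Type*} [NormedAddCommGroup E]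

/-! ### Tuples with repeated entries -/

section Patterns

variable (ι) in
/-- The ways in which the entries of an `ι`-tuple can coincide, for tuples with repeated
entries. -/
def Pattern : Type _ :=
  Σ d : Fin (Fintype.card ι), {π : ι → Fin d // Function.Surjective π}

instance : Finite (Pattern ι) :=
  inferInstanceAs (Finite (Σ d : Fin (Fintype.card ι), {π : ι → Fin d // Function.Surjective π}))

noncomputable instance : Fintype (Pattern ι) := Fintype.ofFinite _

theorem Pattern.pos (p : Pattern ι) : 0 < (p.1 : ℕ) := by
  have h : 0 < Fintype.card ι := p.1.pos
  obtain ⟨a⟩ := Fintype.card_pos_iff.1 h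
  exact (p.2.1 a).pos

/-- Factor the tuple through its range, which has fewer than `Fintype.card ι` points, and enumerate
that range. -/
theorem exists_pattern_comp {α : Type*} (i : ι → α) (hi : ¬ Function.Injective i) :
    ∃ (p : Pattern ι) (e : Fin p.1 ↪ α), ∀ a, e (p.2.1 a) = i a := by
  classical
  have hlt : Fintype.card (Set.range i) < Fintype.card ι := by
    refine lt_of_le_of_ne (Fintype.card_le_of_surjective _ Set.rangeFactorization_surjective)
      fun h => hi ?_
    have hb := (Fintype.bijective_iff_surjective_and_card (Set.rangeFactorization i)).2
      ⟨Set.rangeFactorization_surjective, h.symm⟩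
    exact fun a b hab => hb.1 (Subtype.ext hab)
  let eq := Fintype.equivFin (Set.range i)
  refine ⟨Sigma.mk ⟨_, hlt⟩ ⟨fun a => eq (Set.rangeFactorization i a),
    eq.surjective.comp Set.rangeFactorization_surjective⟩,
    eq.symm.toEmbedding.trans (Function.Embedding.subtype _), fun a => ?_⟩
  simp

-- Choosing one factorisation per tuple is an injective assignment. Only an inequality results,
-- since relabelling gives the same tuple several factorisations.
open scoped Classical in
theorem sum_not_injective_le {n : ℕ} {F : (ι → Fin n) → ℝ} (hF : ∀ i, 0 ≤ F i) :
    ∑ i : ι → Fin n with ¬ Function.Injective i, F i ≤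
      ∑ p : Pattern ι, ∑ e : Fin p.1 ↪ Fin n, F (fun a => e (p.2.1 a)) := by
  choose P e he using exists_pattern_comp (ι := ι) (α := Fin n)
  let g : (Σ p : Pattern ι, (Fin p.1 ↪ Fin n)) → ι → Fin n := fun q a => q.2 (q.1.2.1 a)
  let s : {i : ι → Fin n // ¬ Function.Injective i} → Σ p : Pattern ι, (Fin p.1 ↪ Fin n) :=
    fun i => ⟨P i.1 i.2, e i.1 i.2⟩
  have hgs : ∀ i, g (s i) = i.1 := fun i => funext fun a => he i.1 i.2 a
  have hs : Function.Injective s := fun i j hij => Subtype.ext (by rw [← hgs i, ← hgs j, hij])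
  rw [← Fintype.sum_sigma' (fun (p : Pattern ι) (e : Fin p.1 ↪ Fin n) => F fun a => e (p.2.1 a)),
    Finset.sum_subtype (p := fun i : ι → Fin n => ¬ Function.Injective i) _ (by simp)]
  calc ∑ i : {i : ι → Fin n // ¬ Function.Injective i}, F i.1
      = ∑ i : {i : ι → Fin n // ¬ Function.Injective i}, F (g (s i)) := by simp only [hgs]
    _ = ∑ q ∈ Finset.univ.image s, F (g q) := (Finset.sum_image (f := fun q => F (g q)) hs.injOn).symm
    _ ≤ _ := Finset.sum_le_univ_sum_of_nonneg fun q => hF _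

theorem rpow_sum_le_sum_rpow {α : Type*} (s : Finset α) {f : α → ℝ} (hf : ∀ a, 0 ≤ f a) {p : ℝ}
    (hp : 0 < p) (hp1 : p ≤ 1) : (∑ a ∈ s, f a) ^ p ≤ ∑ a ∈ s, f a ^ p := by
  classical
  induction s using Finset.induction_on with
  | empty => simp [Real.zero_rpow hp.ne']
  | insert a s ha ih =>
    rw [Finset.sum_insert ha, Finset.sum_insert ha]
    exact (Real.rpow_add_le_add_rpow (hf a) (Finset.sum_nonneg fun b _ => hf b) hp.le hp1).trans
      (by gcongr)

/-- Truncation at `M`. The bounded part has at most `n ^ d` terms and `d < m`, hence the factor `1 /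
n`. For the rest, raise to the power `p = d / m`: the normalisation becomes `n ^ (-d)`, and
subadditivity of `t ^ p` moves the power inside the sum. -/
theorem inv_mul_sum_embedding_le {d m : ℕ} (hd : 0 < d) (hdm : d < m) {Y : (Fin d → 𝒳) → ℝ}
    (hY : ∀ y, 0 ≤ Y y) {n : ℕ} (hn : 0 < n) (hdn : d ≤ n) (M : ℝ) (hM : 0 ≤ M)
    (x : Fin n → 𝒳) :
    ((n : ℝ) ^ m)⁻¹ * ∑ e : Fin d ↪ Fin n, Y (fun a => x (e a)) ≤
      M * (n : ℝ)⁻¹ + (injAvg ({y | M < Y y}.indicator fun y => Y y ^ ((d : ℝ) / m)) x) ^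
        ((d : ℝ) / m)⁻¹ := by
  have hm : 0 < m := hd.trans hdm
  have hdR : (0 : ℝ) < d := Nat.cast_pos.2 hd
  have hmR : (0 : ℝ) < m := Nat.cast_pos.2 hm
  have hnR : (0 : ℝ) < n := Nat.cast_pos.2 hn
  have hn1 : (1 : ℝ) ≤ n := Nat.one_le_cast.2 hn
  set p : ℝ := (d : ℝ) / m with hp
  have hp0 : 0 < p := by positivity
  have hp1 : p ≤ 1 := div_le_one_of_le₀ (Nat.cast_le.2 hdm.le) hmR.le
  have hcard : (Fintype.card (Fin d ↪ Fin n) : ℝ) ≤ (n : ℝ) ^ d := by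
    have := injRatio_le_one (ι := Fin d) n
    unfold injRatio at this
    rw [div_le_one (by positivity), Fintype.card_fin] at this
    exact this
  have hcard0 : (0 : ℝ) < Fintype.card (Fin d ↪ Fin n) := by
    have := card_embedding_ne_zero (ι := Fin d) (n := n) (by simpa using hdn)
    positivity
  let W : (Fin d → 𝒳) → ℝ := {y | M < Y y}.indicator Y
  have hW : ∀ y, 0 ≤ W y := fun y => Set.indicator_nonneg (fun y _ => hY y) y
  have hYW : ∀ y, Y y ≤ M + W y := fun y => by
    by_cases hy : M < Y y
    · simp only [W, Set.indicator_of_mem (show y ∈ {y | M < Y y} from hy)]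
      linarith
    · simp only [W, Set.indicator_of_notMem (show y ∉ {y | M < Y y} from hy)]
      linarith
  have hWp : ∀ y, W y ^ p = {y | M < Y y}.indicator (fun y => Y y ^ p) y := fun y => by
    by_cases hy : M < Y y
    · simp only [W, Set.indicator_of_mem (show y ∈ {y | M < Y y} from hy)]
    · simp only [W, Set.indicator_of_notMem (show y ∉ {y | M < Y y} from hy),
        Real.zero_rpow hp0.ne']
  have hsW : 0 ≤ ∑ e : Fin d ↪ Fin n, W (fun a => x (e a)) := Finset.sum_nonneg fun e _ => hW _
  calc ((n : ℝ) ^ m)⁻¹ * ∑ e : Fin d ↪ Fin n, Y (fun a => x (e a))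
      ≤ ((n : ℝ) ^ m)⁻¹ * ∑ e : Fin d ↪ Fin n, (M + W (fun a => x (e a))) := by
        gcongr
        exact hYW _
    _ = M * (((n : ℝ) ^ m)⁻¹ * Fintype.card (Fin d ↪ Fin n)) +
        ((n : ℝ) ^ m)⁻¹ * ∑ e : Fin d ↪ Fin n, W (fun a => x (e a)) := by
        rw [Finset.sum_add_distrib, Finset.sum_const, Finset.card_univ, nsmul_eq_mul]
        ring
    _ ≤ _ := by
        refine add_le_add (mul_le_mul_of_nonneg_left ?_ hM) ?_
        · rw [inv_mul_le_iff₀ (by positivity)]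
          refine hcard.trans ?_
          rw [← div_eq_mul_inv, le_div_iff₀ hnR, ← pow_succ]
          exact pow_le_pow_right₀ hn1 hdm
        · rw [Real.le_rpow_inv_iff_of_pos (by positivity) ?_ hp0]
          · rw [Real.mul_rpow (by positivity) hsW]
            have h1 : (((n : ℝ) ^ m)⁻¹) ^ p = ((n : ℝ) ^ d)⁻¹ := by
              rw [Real.inv_rpow (by positivity), ← Real.rpow_natCast, ← Real.rpow_mul hnR.le, hp,
                mul_div_cancel₀ _ hmR.ne', Real.rpow_natCast]
            rw [h1, injAvg, smul_eq_mul]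
            refine mul_le_mul (inv_anti₀ hcard0 hcard)
              ((rpow_sum_le_sum_rpow _ (fun e => hW _) hp0 hp1).trans (le_of_eq ?_))
              (by positivity) (by positivity)
            simp only [hWp]
          · rw [injAvg, smul_eq_mul]
            refine mul_nonneg (by positivity) (Finset.sum_nonneg fun e _ => ?_)
            exact Set.indicator_nonneg (fun y _ => Real.rpow_nonneg (hY y) _) _

variable [MeasurableSpace 𝒳] (μ : Measure 𝒳) [IsProbabilityMeasure μ]

/-- A Marcinkiewicz–Zygmund type law of large numbers for nonnegative kernels. -/
theorem tendsto_inv_pow_mul_sum_embedding {d m : ℕ} (hd : 0 < d) (hdm : d < m)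
    {Y : (Fin d → 𝒳) → ℝ} (hY : ∀ y, 0 ≤ Y y) (hYm : Measurable Y)
    (hYi : Integrable (fun y => Y y ^ ((d : ℝ) / m)) (Measure.pi fun _ : Fin d => μ)) :
    ∀ᵐ x ∂(seqLaw μ), Tendsto
      (fun n : ℕ => ((n : ℝ) ^ m)⁻¹ * ∑ e : Fin d ↪ Fin n, Y (fun a => x (e a))) atTop (𝓝 0) := by
  set p : ℝ := (d : ℝ) / m with hp
  have hp0 : 0 < p := by
    have : 0 < m := hd.trans hdm
    positivity
  let Z : ℕ → (Fin d → 𝒳) → ℝ := fun M => {y | (M : ℝ) < Y y}.indicator fun y => Y y ^ p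
  have hms : ∀ M : ℕ, MeasurableSet {y | (M : ℝ) < Y y} := fun M =>
    measurableSet_lt measurable_const hYm
  have hZ : ∀ M, Integrable (Z M) (Measure.pi fun _ : Fin d => μ) := fun M =>
    hYi.indicator (hms M)
  have hZint : Tendsto (fun M => ∫ y, Z M y ∂(Measure.pi fun _ : Fin d => μ)) atTop (𝓝 0) := by
    have h := tendsto_integral_of_dominated_convergence (F := Z) (f := fun _ => (0 : ℝ))
      (fun y => Y y ^ p) (fun M => (hZ M).aestronglyMeasurable) hYi
      (fun M => ae_of_all _ fun y => by
        rw [← Real.norm_of_nonneg (Real.rpow_nonneg (hY y) p)]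
        exact norm_indicator_le_norm_self _ _)
      (ae_of_all _ fun y => by
        refine tendsto_const_nhds.congr' ?_
        obtain ⟨K, hK⟩ := exists_nat_ge (Y y)
        filter_upwards [eventually_ge_atTop K] with M hM
        have : y ∉ {y | (M : ℝ) < Y y} := fun hy =>
          absurd (hK.trans (Nat.cast_le.2 hM)) (not_le.2 hy)
        exact (Set.indicator_of_notMem this _).symm)
    simpa using h
  have hroot : Tendsto (fun M => (∫ y, Z M y ∂(Measure.pi fun _ : Fin d => μ)) ^ p⁻¹) atTop
      (𝓝 0) := by
    have := hZint.rpow_const (p := p⁻¹) (Or.inr (by positivity))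
    rwa [Real.zero_rpow (by positivity)] at this
  filter_upwards [ae_all_iff.2 fun M => strongLaw_of_integrable μ (hZ M)] with x hx
  refine tendsto_order.2 ⟨fun a ha => Eventually.of_forall fun n => ha.trans_le
    (mul_nonneg (by positivity) (Finset.sum_nonneg fun e _ => hY _)), fun b hb => ?_⟩
  -- The truncation level is fixed before `n` grows, so the term `M / n` disappears.
  obtain ⟨M, hM⟩ := (hroot.eventually (gt_mem_nhds hb)).exists
  have hlim : Tendsto (fun n : ℕ => (M : ℝ) * (n : ℝ)⁻¹ +
      (injAvg (Z M) fun k : Fin n => x k) ^ p⁻¹) atTop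
      (𝓝 (M * 0 + (∫ y, Z M y ∂(Measure.pi fun _ : Fin d => μ)) ^ p⁻¹)) :=
    (tendsto_inv_atTop_nhds_zero_nat.const_mul _).add
      ((hx M).rpow_const (Or.inr (by positivity)))
  rw [mul_zero, zero_add] at hlim
  filter_upwards [hlim.eventually (gt_mem_nhds hM), eventually_gt_atTop 0,
    eventually_ge_atTop d] with n hn hn0 hdn
  exact (inv_mul_sum_embedding_le hd hdm hY hn0 hdn M (Nat.cast_nonneg M)
    (fun k : Fin n => x k)).trans_lt hn

/-- The moment condition on the values of a kernel at tuples with repeated entries. -/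
def PatternMoment (φ : (ι → 𝒳) → E) : Prop :=
  ∀ p : Pattern ι, Integrable (fun y : Fin p.1 → 𝒳 =>
    ‖φ (fun a => y (p.2.1 a))‖ ^ (((p.1 : ℕ) : ℝ) / Fintype.card ι))
      (Measure.pi fun _ : Fin p.1 => μ)

theorem ae_tendsto_nonInjAvg_norm {φ : (ι → 𝒳) → E} (hm : Measurable fun y => ‖φ y‖)
    (hφ : PatternMoment μ φ) :
    ∀ᵐ x ∂(seqLaw μ), Tendsto
      (fun n : ℕ => nonInjAvg (fun y => ‖φ y‖) fun k : Fin n => x k) atTop (𝓝 0) := by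
  have h : ∀ p : Pattern ι, _ := fun p =>
    tendsto_inv_pow_mul_sum_embedding μ (Pattern.pos p) p.1.2
      (Y := fun y => ‖φ (fun a => y (p.2.1 a))‖) (fun y => norm_nonneg _)
      (hm.comp (by fun_prop : Measurable fun (y : Fin p.1 → 𝒳) a => y (p.2.1 a))) (hφ p)
  filter_upwards [ae_all_iff.2 h] with x hx
  have hlim := tendsto_finsetSum (Finset.univ : Finset (Pattern ι)) fun p _ => hx p
  rw [Finset.sum_const_zero] at hlim
  refine squeeze_zero (fun n => nonInjAvg_nonneg (fun y => norm_nonneg _) _) (fun n => ?_) hlim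
  rw [nonInjAvg, smul_eq_mul, ← Finset.mul_sum]
  gcongr
  exact sum_not_injective_le (F := fun i : ι → Fin n => ‖φ (fun a => x (i a))‖)
    fun i => norm_nonneg _

end Patterns

end UVStat

namespace UVStat

variable {𝒳 : Type*} {ι : Type*} [Fintype ι] {E : Type*} [NormedAddCommGroup E] [NormedSpace ℝ E]

/-! ### Conditional means over bootstrap samples -/

section Bootstrap

/-- The mean of a function of `n` independent uniformly distributed indices. -/
noncomputable def bootAvg {n : ℕ} (F : (Fin n → Fin n) → ℝ) : ℝ :=
  ((n : ℝ) ^ n)⁻¹ * ∑ j : Fin n → Fin n, F j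

theorem bootAvg_mono {n : ℕ} {F G : (Fin n → Fin n) → ℝ} (h : ∀ j, F j ≤ G j) :
    bootAvg F ≤ bootAvg G := by
  unfold bootAvg
  gcongr
  exact h _

theorem bootAvg_nonneg {n : ℕ} {F : (Fin n → Fin n) → ℝ} (h : ∀ j, 0 ≤ F j) :
    0 ≤ bootAvg F :=
  mul_nonneg (by positivity) (Finset.sum_nonneg fun j _ => h j)

theorem bootAvg_add {n : ℕ} (F G : (Fin n → Fin n) → ℝ) :
    bootAvg (fun j => F j + G j) = bootAvg F + bootAvg G := by
  simp [bootAvg, Finset.sum_add_distrib, mul_add]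

theorem bootAvg_const_mul {n : ℕ} (c : ℝ) (F : (Fin n → Fin n) → ℝ) :
    bootAvg (fun j => c * F j) = c * bootAvg F := by
  simp only [bootAvg, ← Finset.mul_sum]
  ring

theorem bootAvg_sum {n : ℕ} {α : Type*} (s : Finset α) (F : α → (Fin n → Fin n) → ℝ) :
    bootAvg (fun j => ∑ a ∈ s, F a j) = ∑ a ∈ s, bootAvg (F a) := by
  simp only [bootAvg]
  rw [Finset.sum_comm, Finset.mul_sum]

theorem bootAvg_const {n : ℕ} (c : ℝ) : bootAvg (fun _ : Fin n → Fin n => c) = c := by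
  have h : ((n : ℝ) ^ n) ≠ 0 := by
    -- For `n = 0` the normalisation is `0 ^ 0 = 1`.
    rcases eq_or_ne n 0 with rfl | h
    · simp
    · have : (n : ℝ) ≠ 0 := Nat.cast_ne_zero.2 h
      positivity
  simp only [bootAvg, Finset.sum_const, Finset.card_univ, Fintype.card_fun, Fintype.card_fin,
    nsmul_eq_mul, Nat.cast_pow]
  rw [inv_mul_cancel_left₀ h]

theorem bootAvg_add_const {n : ℕ} (F : (Fin n → Fin n) → ℝ) (c : ℝ) :
    bootAvg (fun j => F j + c) = bootAvg F + c := by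
  rw [bootAvg_add, bootAvg_const]

theorem sq_bootAvg_le {n : ℕ} (F : (Fin n → Fin n) → ℝ) :
    bootAvg F ^ 2 ≤ bootAvg fun j => F j ^ 2 := by
  have h : bootAvg (fun j => (F j - bootAvg F) ^ 2) = bootAvg (fun j => F j ^ 2) - bootAvg F ^ 2 := by
    have : ∀ j, (F j - bootAvg F) ^ 2 = F j ^ 2 + ((-2 * bootAvg F) * F j + bootAvg F ^ 2) :=
      fun j => by ring
    simp only [this]
    rw [bootAvg_add, bootAvg_add, bootAvg_const_mul, bootAvg_const]
    ring
  have h0 : 0 ≤ bootAvg (fun j => (F j - bootAvg F) ^ 2) := bootAvg_nonneg fun j => sq_nonneg _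
  linarith

/-- Coordinates at distinct positions of a uniform index map are themselves uniform and independent;
the remaining ones sum out to a power of `n`. -/
theorem bootAvg_comp_embedding [DecidableEq ι] {n : ℕ} (e : ι ↪ Fin n) (F : (ι → Fin n) → ℝ) :
    bootAvg (fun j => F fun a => j (e a)) =
      ((n : ℝ) ^ Fintype.card ι)⁻¹ * ∑ k : ι → Fin n, F k := by
  classical
  have hle : Fintype.card ι ≤ n := by simpa using Fintype.card_le_of_embedding e
  let eq : (Fin n → Fin n) ≃ (ι → Fin n) × ({b // b ∉ Set.range e} → Fin n) :=
    (Equiv.piEquivPiSubtypeProd (· ∈ Set.range e) fun _ => Fin n).trans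
      (Equiv.prodCongr ((Equiv.ofInjective e e.injective).symm.arrowCongr (Equiv.refl _))
        (Equiv.refl _))
  have heq : ∀ j, (eq j).1 = fun a => j (e a) := fun j => rfl
  have hcard : Fintype.card {b // b ∉ Set.range e} = n - Fintype.card ι := by
    rw [Fintype.card_subtype_compl, Fintype.card_fin]
    congr 1
    exact (Fintype.card_congr (Equiv.ofInjective e e.injective)).symm
  have hsum : ∑ j : Fin n → Fin n, F (fun a => j (e a)) =
      (n : ℝ) ^ (n - Fintype.card ι) * ∑ k : ι → Fin n, F k := by
    simp only [← heq]
    rw [Equiv.sum_comp eq fun q => F q.1, Fintype.sum_prod_type, Finset.mul_sum]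
    simp only [Finset.sum_const, Finset.card_univ, Fintype.card_fun, hcard, Fintype.card_fin,
      nsmul_eq_mul, Nat.cast_pow]
  unfold bootAvg
  rw [hsum, ← mul_assoc]
  congr 1
  rcases Nat.eq_zero_or_pos n with rfl | hn
  · have : Fintype.card ι = 0 := by omega
    simp [this]
  · have : (n : ℝ) ≠ 0 := Nat.cast_ne_zero.2 hn.ne'
    rw [← Nat.sub_add_cancel hle, Nat.add_sub_cancel, pow_add]
    field_simp

/-- Each injective tuple of positions has the same conditional mean, namely the V-average of the
data. -/
theorem bootAvg_injAvg (f : (ι → 𝒳) → ℝ) {n : ℕ} (hn : Fintype.card ι ≤ n) (x : Fin n → 𝒳) :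
    bootAvg (fun j => injAvg f fun k => x (j k)) = vAvg f x := by
  classical
  have h0 : (Fintype.card (ι ↪ Fin n) : ℝ) ≠ 0 := Nat.cast_ne_zero.2 (card_embedding_ne_zero hn)
  simp only [injAvg, smul_eq_mul]
  rw [bootAvg_const_mul, bootAvg_sum]
  simp only [fun e : ι ↪ Fin n => bootAvg_comp_embedding e fun i => f fun a => x (i a)]
  rw [Finset.sum_const, Finset.card_univ, nsmul_eq_mul, inv_mul_cancel_left₀ h0, vAvg, smul_eq_mul]

/-- For a pattern with `d` values, at most `n ^ d` embeddings each have mean `n ^ (-d)` times a sum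
over `k : Fin d → Fin n`. Composing `k` with the pattern is injective in `k`, as the pattern is
surjective, and yields a tuple with repetitions, as `d < m`; so each pattern costs at most one copy
of the repeated sum. -/
theorem bootAvg_nonInjAvg_le {f : (ι → 𝒳) → ℝ} (hf : ∀ y, 0 ≤ f y) {n : ℕ} (x : Fin n → 𝒳) :
    bootAvg (fun j => nonInjAvg f fun k => x (j k)) ≤
      Fintype.card (Pattern ι) * nonInjAvg f x := by
  classical
  have hp : ∀ p : Pattern ι, ∑ k : Fin p.1 → Fin n, f (fun a => x (k (p.2.1 a))) ≤
      ∑ i : ι → Fin n with ¬ Function.Injective i, f (fun a => x (i a)) := fun p => by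
    let s : (Fin p.1 → Fin n) → ι → Fin n := fun k a => k (p.2.1 a)
    have hs : Function.Injective s := fun k l hkl => p.2.2.injective_comp_right hkl
    calc ∑ k : Fin p.1 → Fin n, f (fun a => x (k (p.2.1 a)))
        = ∑ i ∈ Finset.univ.image s, f (fun a => x (i a)) :=
          (Finset.sum_image (f := fun i : ι → Fin n => f fun a => x (i a)) hs.injOn).symm
      _ ≤ _ := by
          refine Finset.sum_le_sum_of_subset_of_nonneg (fun i hi => ?_) fun i _ _ => hf _
          obtain ⟨k, -, rfl⟩ := Finset.mem_image.1 hi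
          refine Finset.mem_filter.2 ⟨Finset.mem_univ _, fun hinj => ?_⟩
          have h1 : Function.Injective p.2.1 := fun a b hab => hinj (congrArg k hab)
          have h2 := Fintype.card_le_of_injective _ h1
          rw [Fintype.card_fin] at h2
          exact absurd p.1.2 (not_lt.2 h2)
  have he : ∀ (p : Pattern ι), ∑ e : Fin p.1 ↪ Fin n,
      bootAvg (fun j => f fun a => x (j (e (p.2.1 a)))) ≤
      ∑ i : ι → Fin n with ¬ Function.Injective i, f (fun a => x (i a)) := fun p => by
    refine le_trans ?_ (hp p)
    simp only [fun e : Fin p.1 ↪ Fin n =>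
      bootAvg_comp_embedding e fun k => f fun a => x (k (p.2.1 a))]
    rw [Finset.sum_const, Finset.card_univ, nsmul_eq_mul, ← mul_assoc, ← div_eq_mul_inv]
    have hr : (Fintype.card (Fin p.1 ↪ Fin n) : ℝ) / (n : ℝ) ^ Fintype.card (Fin p.1) ≤ 1 :=
      injRatio_le_one n
    exact mul_le_of_le_one_left
      (Finset.sum_nonneg fun (k : Fin p.1 → Fin n) _ => hf fun a => x (k (p.2.1 a))) hr
  calc bootAvg (fun j => nonInjAvg f fun k => x (j k))
      ≤ bootAvg (fun j => ((n : ℝ) ^ Fintype.card ι)⁻¹ *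
          ∑ p : Pattern ι, ∑ e : Fin p.1 ↪ Fin n, f fun a => x (j (e (p.2.1 a)))) := by
        refine bootAvg_mono fun j => ?_
        rw [nonInjAvg, smul_eq_mul]
        gcongr
        exact sum_not_injective_le (F := fun i : ι → Fin n => f fun a => x (j (i a)))
          fun i => hf _
    _ = ((n : ℝ) ^ Fintype.card ι)⁻¹ * ∑ p : Pattern ι, ∑ e : Fin p.1 ↪ Fin n,
          bootAvg (fun j => f fun a => x (j (e (p.2.1 a)))) := by
        rw [bootAvg_const_mul, bootAvg_sum]
        simp only [bootAvg_sum]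
    _ ≤ ((n : ℝ) ^ Fintype.card ι)⁻¹ * ∑ p : Pattern ι,
          ∑ i : ι → Fin n with ¬ Function.Injective i, f (fun a => x (i a)) := by
        gcongr with p
        exact he p
    _ = _ := by
        rw [Finset.sum_const, Finset.card_univ, nsmul_eq_mul, nonInjAvg, smul_eq_mul]
        ring

theorem bootAvg_vAvg (f : (ι → 𝒳) → ℝ) {n : ℕ} (hn : Fintype.card ι ≤ n) (x : Fin n → 𝒳) :
    bootAvg (fun j => vAvg f fun k => x (j k)) =
      injRatio ι n * vAvg f x + bootAvg (fun j => nonInjAvg f fun k => x (j k)) := by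
  have h : (fun j : Fin n → Fin n => vAvg f fun k => x (j k)) = fun j =>
      injRatio ι n * (injAvg f fun k => x (j k)) + nonInjAvg f fun k => x (j k) :=
    funext fun j => by rw [vAvg_eq, smul_eq_mul]
  rw [h, bootAvg_add, bootAvg_const_mul, bootAvg_injAvg f hn]

theorem bootAvg_vAvg_le {f : (ι → 𝒳) → ℝ} (hf : ∀ y, 0 ≤ f y) {n : ℕ}
    (hn : Fintype.card ι ≤ n) (x : Fin n → 𝒳) :
    bootAvg (fun j => vAvg f fun k => x (j k)) ≤
      vAvg f x + Fintype.card (Pattern ι) * nonInjAvg f x := by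
  rw [bootAvg_vAvg f hn]
  refine add_le_add (mul_le_of_le_one_left ?_ (injRatio_le_one n)) (bootAvg_nonInjAvg_le hf x)
  rw [vAvg, smul_eq_mul]
  exact mul_nonneg (by positivity) (Finset.sum_nonneg fun i _ => hf _)

theorem abs_vAvg_le {f : (ι → 𝒳) → ℝ} {C : ℝ} (hC : ∀ y, |f y| ≤ C) {n : ℕ} (hn : n ≠ 0)
    (x : Fin n → 𝒳) : |vAvg f x| ≤ C := by
  rw [← vAvg_const (ι := ι) C hn x]
  refine (norm_vAvg_le f x).trans ?_
  simp only [vAvg, smul_eq_mul]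
  gcongr
  exact hC _

theorem abs_bootAvg_vAvg_sub_le {f : (ι → 𝒳) → ℝ} {C : ℝ} (hC : ∀ y, |f y| ≤ C) {n : ℕ}
    (hn : Fintype.card ι ≤ n) (hn0 : n ≠ 0) (x : Fin n → 𝒳) :
    |bootAvg (fun j => vAvg f fun k => x (j k)) - vAvg f x| ≤ 2 * C * (1 - injRatio ι n) := by
  have hN : ∀ j : Fin n → Fin n, |nonInjAvg f fun k => x (j k)| ≤ C * (1 - injRatio ι n) :=
    fun j => by
      rw [← nonInjAvg_const C hn0 hn fun k => x (j k)]
      exact (norm_nonInjAvg_le _ _).trans (nonInjAvg_mono (f := fun y => ‖f y‖) hC _)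
  have h2 : |bootAvg (fun j => nonInjAvg f fun k => x (j k))| ≤ C * (1 - injRatio ι n) := by
    rw [abs_le]
    constructor
    · rw [← bootAvg_const (n := n) (-(C * (1 - injRatio ι n)))]
      exact bootAvg_mono fun j => (abs_le.1 (hN j)).1
    · rw [← bootAvg_const (n := n) (C * (1 - injRatio ι n))]
      exact bootAvg_mono fun j => (abs_le.1 (hN j)).2
  have h3 : |(1 - injRatio ι n) * vAvg f x| ≤ (1 - injRatio ι n) * C := by
    have h0 : 0 ≤ 1 - injRatio ι n := sub_nonneg.2 (injRatio_le_one n)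
    rw [abs_mul, abs_of_nonneg h0]
    exact mul_le_mul_of_nonneg_left (abs_vAvg_le hC hn0 x) h0
  rw [bootAvg_vAvg f hn, abs_le]
  rw [abs_le] at h2 h3
  constructor <;> linarith [h2.1, h2.2, h3.1, h3.2]

theorem vAvg_mul_self (f : (ι → 𝒳) → ℝ) {n : ℕ} (x : Fin n → 𝒳) :
    vAvg (fun y : ι ⊕ ι → 𝒳 => f (fun a => y (Sum.inl a)) * f (fun a => y (Sum.inr a))) x =
      vAvg f x ^ 2 := by
  classical
  simp only [vAvg, smul_eq_mul, Fintype.card_sum]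
  rw [sq, mul_mul_mul_comm, ← mul_inv, ← pow_add, Finset.sum_mul_sum]
  congr 1
  refine Eq.trans (Finset.sum_congr (by ext; simp) fun i _ => rfl)
    ((Fintype.sum_equiv (Equiv.sumArrowEquivProdArrow ι ι (Fin n)) _
    (fun q => f (fun a => x (q.1 a)) * f (fun a => x (q.2 a))) fun i => rfl).trans
    (Fintype.sum_prod_type _))

/-- For bounded kernels conditional means of V-averages follow the data. Applied to the kernel and
to its product with an independent copy, this gives the first two conditional moments, so the mean
square deviation from `c` tends to zero. -/
theorem tendsto_bootAvg_abs_vAvg_sub {f : (ι → 𝒳) → ℝ} {C : ℝ} (hC : ∀ y, |f y| ≤ C)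
    {x : ∀ n, Fin n → 𝒳} {c : ℝ} (hx : Tendsto (fun n => vAvg f (x n)) atTop (𝓝 c)) :
    Tendsto (fun n => bootAvg fun j => |vAvg f (fun k => x n (j k)) - c|) atTop (𝓝 0) := by
  let g : (ι ⊕ ι → 𝒳) → ℝ := fun y => f (fun a => y (Sum.inl a)) * f (fun a => y (Sum.inr a))
  have hg : ∀ y, |g y| ≤ C * C := fun y => by
    rw [abs_mul]
    exact mul_le_mul (hC _) (hC _) (abs_nonneg _) ((abs_nonneg _).trans (hC fun a => y (Sum.inl a)))
  have hmean : ∀ {κ : Type _} [Fintype κ] {u : (κ → 𝒳) → ℝ} {K b : ℝ}, (∀ y, |u y| ≤ K) →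
      Tendsto (fun n => vAvg u (x n)) atTop (𝓝 b) →
      Tendsto (fun n => bootAvg fun j => vAvg u (fun k => x n (j k))) atTop (𝓝 b) := by
    intro κ _ u K b hu hb
    have h0 : Tendsto (fun n => 2 * K * (1 - injRatio κ n)) atTop (𝓝 0) := by
      have := ((tendsto_injRatio κ).const_sub 1).const_mul (2 * K)
      rwa [sub_self, mul_zero] at this
    have h1 : Tendsto (fun n => (bootAvg fun j => vAvg u (fun k => x n (j k))) - vAvg u (x n))
        atTop (𝓝 0) := by
      refine squeeze_zero_norm' ?_ h0
      filter_upwards [eventually_ge_atTop (Fintype.card κ), eventually_gt_atTop 0] with n hn hn0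
      exact abs_bootAvg_vAvg_sub_le hu hn hn0.ne' (x n)
    simpa using h1.add hb
  have h1 := hmean hC hx
  have h2 := hmean hg (b := c ^ 2) (by
    simp only [g, vAvg_mul_self]
    exact hx.pow 2)
  simp only [g, vAvg_mul_self] at h2
  have h3 : Tendsto (fun n => bootAvg fun j => (vAvg f (fun k => x n (j k)) - c) ^ 2) atTop
      (𝓝 0) := by
    have h := (h2.add (h1.const_mul (-2 * c))).add_const (c ^ 2)
    have hz : c ^ 2 + -2 * c * c + c ^ 2 = 0 := by ring
    rw [hz] at h
    refine h.congr fun n => ?_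
    rw [← bootAvg_const_mul, ← bootAvg_add, ← bootAvg_add_const]
    congr 1
    funext j
    ring
  have h4 : Tendsto (fun n => (bootAvg fun j => |vAvg f (fun k => x n (j k)) - c|) ^ 2) atTop
      (𝓝 0) := by
    refine squeeze_zero (fun n => sq_nonneg _) (fun n => (sq_bootAvg_le _).trans (le_of_eq ?_)) h3
    simp only [sq_abs]
  have h5 := h4.sqrt
  rw [Real.sqrt_zero] at h5
  refine h5.congr fun n => Real.sqrt_sq (bootAvg_nonneg fun j => abs_nonneg _)

theorem vAvg_add (φ ψ : (ι → 𝒳) → E) {n : ℕ} (x : Fin n → 𝒳) :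
    vAvg (φ + ψ) x = vAvg φ x + vAvg ψ x := by
  simp [vAvg, Finset.sum_add_distrib]

theorem vAvg_sub (φ ψ : (ι → 𝒳) → E) {n : ℕ} (x : Fin n → 𝒳) :
    vAvg (φ - ψ) x = vAvg φ x - vAvg ψ x := by
  simp [vAvg, Finset.sum_sub_distrib, smul_sub]

theorem vAvg_smul_const (f : (ι → 𝒳) → ℝ) (c : E) {n : ℕ} (x : Fin n → 𝒳) :
    vAvg (fun y => f y • c) x = vAvg f x • c := by
  simp [vAvg, ← Finset.sum_smul, smul_smul]

/-- With `r` the injective ratio and `N` the repeated part, `r (U - g) = (V - g) - N + (1 - r) g`,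
and each term on the right is small in conditional mean. -/
theorem tendsto_bootAvg_norm_injAvg_sub {φ : (ι → 𝒳) → E} {x : ∀ n, Fin n → 𝒳} {g : E}
    (hN : Tendsto (fun n => nonInjAvg (fun y => ‖φ y‖) (x n)) atTop (𝓝 0))
    (hV : Tendsto (fun n => bootAvg fun j => ‖vAvg φ (fun k => x n (j k)) - g‖) atTop (𝓝 0)) :
    Tendsto (fun n => bootAvg fun j => ‖injAvg φ (fun k => x n (j k)) - g‖) atTop (𝓝 0) := by
  have hr := tendsto_injRatio ι
  have h := (hr.inv₀ one_ne_zero).mul ((hV.add (hN.const_mul (Fintype.card (Pattern ι) : ℝ))).add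
    ((hr.const_sub 1).mul_const ‖g‖))
  rw [mul_zero, add_zero, sub_self, zero_mul, add_zero, mul_zero] at h
  refine squeeze_zero' (Eventually.of_forall fun n => bootAvg_nonneg fun j => norm_nonneg _) ?_ h
  filter_upwards [eventually_ge_atTop (Fintype.card ι), eventually_gt_atTop 0] with n hn hn0
  have hpos := injRatio_pos hn hn0.ne'
  have h1 : 0 ≤ 1 - injRatio ι n := sub_nonneg.2 (injRatio_le_one n)
  rw [le_inv_mul_iff₀ hpos, ← bootAvg_const_mul]
  refine le_trans ?_ (add_le_add (add_le_add le_rfl (bootAvg_nonInjAvg_le (fun y => norm_nonneg _)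
    (x n))) le_rfl)
  rw [← bootAvg_add, ← bootAvg_add_const]
  refine bootAvg_mono fun j => ?_
  calc injRatio ι n * ‖injAvg φ (fun k => x n (j k)) - g‖
      = ‖(vAvg φ (fun k => x n (j k)) - g) - nonInjAvg φ (fun k => x n (j k)) +
          (1 - injRatio ι n) • g‖ := by
        rw [vAvg_eq, ← Real.norm_of_nonneg hpos.le, ← norm_smul, Real.norm_of_nonneg hpos.le,
          sub_smul, one_smul, smul_sub]
        congr 1
        abel
    _ ≤ _ := by
        refine (norm_add_le _ _).trans (add_le_add ((norm_sub_le _ _).trans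
          (add_le_add le_rfl (norm_nonInjAvg_le _ _))) ?_)
        rw [norm_smul, Real.norm_of_nonneg h1]

variable [MeasurableSpace 𝒳] (μ : Measure 𝒳) [IsProbabilityMeasure μ]

/-- The bootstrap law of large numbers, in conditional mean, for the V-statistics with
kernel `φ`. -/
def BootLaw (φ : (ι → 𝒳) → E) : Prop :=
  ∀ᵐ x ∂(seqLaw μ), Tendsto (fun n => bootAvg fun j =>
    ‖vAvg φ (fun k : Fin n => x (j k)) - ∫ y, φ y ∂(Measure.pi fun _ : ι => μ)‖) atTop (𝓝 0)

theorem bootLaw_simpleFunc [CompleteSpace E] (ψ : SimpleFunc (ι → 𝒳) E) : BootLaw μ ψ := by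
  have hint : ∀ ψ : SimpleFunc (ι → 𝒳) E, Integrable ψ (Measure.pi fun _ : ι => μ) :=
    fun ψ => ψ.integrable_of_isFiniteMeasure
  induction ψ using SimpleFunc.induction with
  | const c hs =>
    rename_i s
    have heq : ⇑(SimpleFunc.piecewise s hs (SimpleFunc.const _ c) (SimpleFunc.const _ 0)) =
        fun y => s.indicator (fun _ => (1 : ℝ)) y • c := by
      funext y
      by_cases hy : y ∈ s <;> simp [hy]
    have hb : ∀ y, |s.indicator (fun _ => (1 : ℝ)) y| ≤ 1 := fun y => by
      by_cases hy : y ∈ s <;> simp [hy]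
    rw [heq]
    have hsl := strongLaw_of_integrable μ (φ := s.indicator fun _ => (1 : ℝ))
      ((integrable_const _).indicator hs)
    filter_upwards [hsl] with x hx
    have h := tendsto_bootAvg_abs_vAvg_sub hb (tendsto_vAvg_of_tendsto_injAvg
      (tendsto_nonInjAvg_of_bounded hb fun n (k : Fin n) => x k) hx)
    have h' := h.mul_const ‖c‖
    rw [zero_mul] at h'
    refine h'.congr fun n => ?_
    rw [mul_comm, ← bootAvg_const_mul]
    congr 1
    funext j
    rw [integral_smul_const, vAvg_smul_const, ← sub_smul, norm_smul, mul_comm, Real.norm_eq_abs]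
  | add hfg hf hg =>
    rename_i f g
    filter_upwards [hf, hg] with x hx hx'
    have h := hx.add hx'
    rw [add_zero] at h
    refine squeeze_zero (fun n => bootAvg_nonneg fun j => norm_nonneg _) (fun n => ?_) h
    rw [← bootAvg_add]
    refine bootAvg_mono fun j => ?_
    have h1 : ∫ y, (f + g) y ∂(Measure.pi fun _ : ι => μ) = _ :=
      integral_add (hint f) (hint g)
    rw [h1, SimpleFunc.coe_add, vAvg_add, add_sub_add_comm]
    exact norm_add_le _ _

/-- Approximate by simple kernels in L¹. The error has conditional mean at most the V-average of its
norm plus repeated terms, and these converge to the L¹ distance. -/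
theorem bootLaw_of_patternMoment [CompleteSpace E] [MeasurableSpace E] [BorelSpace E]
    [SecondCountableTopology E] {φ : (ι → 𝒳) → E} (hm : Measurable φ)
    (hφ : Integrable φ (Measure.pi fun _ : ι => μ)) (hφp : PatternMoment μ φ) : BootLaw μ φ := by
  set π := Measure.pi fun _ : ι => μ
  have happrox : ∀ k : ℕ, ∃ ψ : SimpleFunc (ι → 𝒳) E, ∫ y, ‖φ y - ψ y‖ ∂π < 1 / ((k : ℝ) + 1) :=
    fun k => by
      have hk : (0 : ℝ) < 1 / ((k : ℝ) + 1) := by positivity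
      obtain ⟨ψ, hψ, hψi⟩ := (memLp_one_iff_integrable.2 hφ).exists_simpleFunc_eLpNorm_sub_lt
        ENNReal.one_ne_top (ε := ENNReal.ofReal (1 / ((k : ℝ) + 1)))
        (ENNReal.ofReal_pos.2 hk).ne'
      refine ⟨ψ, ?_⟩
      rw [eLpNorm_one_eq_lintegral_enorm] at hψ
      have hint := integral_norm_eq_lintegral_enorm
        (hφ.sub (memLp_one_iff_integrable.1 hψi)).aestronglyMeasurable
      simp only [Pi.sub_apply] at hint hψ
      rw [hint]
      exact (ENNReal.lt_ofReal_iff_toReal_lt (hψ.trans ENNReal.ofReal_lt_top).ne).1 hψ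
  choose ψ hψ using happrox
  have hψi : ∀ k, Integrable (ψ k) π := fun k => (ψ k).integrable_of_isFiniteMeasure
  have hsl := fun k => strongLaw_of_integrable μ (hφ.sub (hψi k)).norm
  filter_upwards [ae_all_iff.2 hsl, ae_all_iff.2 fun k => bootLaw_simpleFunc μ (ψ k),
    ae_tendsto_nonInjAvg_norm μ hm.norm hφp] with x hxs hxb hxN
  -- Simple functions are bounded, so subtracting one does not spoil the negligibility of the
  -- repeated tuples.
  have hN : ∀ k, Tendsto (fun n => nonInjAvg (fun y => ‖(φ - ψ k) y‖) fun i : Fin n => x i) atTop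
      (𝓝 0) := fun k => by
    obtain ⟨C, hC⟩ := (ψ k).exists_forall_norm_le
    have h := hxN.add (tendsto_nonInjAvg_const (ι := ι) C fun n (i : Fin n) => x i)
    rw [add_zero] at h
    refine squeeze_zero (fun n => nonInjAvg_nonneg (fun y => norm_nonneg _) _) (fun n => ?_) h
    rw [← nonInjAvg_add]
    refine nonInjAvg_mono (fun y => ?_) _
    exact (norm_sub_le _ _).trans (add_le_add le_rfl (hC y))
  have hlim : ∀ k, Tendsto (fun n : ℕ => (vAvg (fun y => ‖(φ - ψ k) y‖) (fun i : Fin n => x i) +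
      Fintype.card (Pattern ι) * nonInjAvg (fun y => ‖(φ - ψ k) y‖) fun i : Fin n => x i) +
      (bootAvg fun j => ‖vAvg (ψ k) (fun i : Fin n => x (j i)) - ∫ y, ψ k y ∂π‖) +
      ‖(∫ y, ψ k y ∂π) - ∫ y, φ y ∂π‖) atTop
      (𝓝 ((∫ y, ‖(φ - ψ k) y‖ ∂π) + Fintype.card (Pattern ι) * 0 + 0 +
        ‖(∫ y, ψ k y ∂π) - ∫ y, φ y ∂π‖)) := fun k =>
    (((tendsto_vAvg_of_tendsto_injAvg (hN k) (hxs k)).add ((hN k).const_mul _)).add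
      (hxb k)).add_const _
  have hle : ∀ k, ∀ᶠ n : ℕ in atTop,
      (bootAvg fun j => ‖vAvg φ (fun i : Fin n => x (j i)) - ∫ y, φ y ∂π‖) ≤
      (vAvg (fun y => ‖(φ - ψ k) y‖) (fun i : Fin n => x i) +
      Fintype.card (Pattern ι) * nonInjAvg (fun y => ‖(φ - ψ k) y‖) fun i : Fin n => x i) +
      (bootAvg fun j => ‖vAvg (ψ k) (fun i : Fin n => x (j i)) - ∫ y, ψ k y ∂π‖) +
      ‖(∫ y, ψ k y ∂π) - ∫ y, φ y ∂π‖ := fun k => by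
    filter_upwards [eventually_ge_atTop (Fintype.card ι)] with n hn
    refine le_trans ?_ (add_le_add (add_le_add (bootAvg_vAvg_le (fun y => norm_nonneg _) hn _)
      le_rfl) le_rfl)
    rw [← bootAvg_add, ← bootAvg_add_const]
    refine bootAvg_mono fun j => ?_
    calc ‖vAvg φ (fun i : Fin n => x (j i)) - ∫ y, φ y ∂π‖
        = ‖vAvg (φ - ⇑(ψ k)) (fun i : Fin n => x (j i)) +
            (vAvg (ψ k) (fun i : Fin n => x (j i)) - ∫ y, ψ k y ∂π) +
            ((∫ y, ψ k y ∂π) - ∫ y, φ y ∂π)‖ := by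
          rw [vAvg_sub]
          congr 1
          abel
      _ ≤ _ := (norm_add₃_le).trans (add_le_add (add_le_add (norm_vAvg_le _ _) le_rfl) le_rfl)
  refine tendsto_order.2 ⟨fun a ha => Eventually.of_forall fun n => ha.trans_le
    (bootAvg_nonneg fun j => norm_nonneg _), fun b hb => ?_⟩
  -- Half of `b`, because the L¹ distance enters twice: through the averages and through the means.
  obtain ⟨k, hk⟩ := exists_nat_one_div_lt (half_pos hb)
  have h1 : (∫ y, ‖(φ - ψ k) y‖ ∂π) < b / 2 := (hψ k).trans hk
  have h2 : ‖(∫ y, ψ k y ∂π) - ∫ y, φ y ∂π‖ ≤ ∫ y, ‖(φ - ψ k) y‖ ∂π := by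
    rw [norm_sub_rev, ← integral_sub hφ (hψi k)]
    exact norm_integral_le_integral_norm _
  have h3 : (∫ y, ‖(φ - ψ k) y‖ ∂π) + Fintype.card (Pattern ι) * 0 + 0 +
        ‖(∫ y, ψ k y ∂π) - ∫ y, φ y ∂π‖ < b := by linarith
  filter_upwards [(hlim k).eventually (gt_mem_nhds h3), hle k] with n hn hn'
  exact hn'.trans_lt hn

end Bootstrap

end UVStat

namespace UVStat

variable {𝒳 : Type*}

/-! ### From increasing tuples to injective tuples -/

section Symmetric

variable {E : Type*} [NormedAddCommGroup E] [NormedSpace ℝ E]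

theorem vStat_eq_vAvg {m n : ℕ} (φ : (Fin m → 𝒳) → E) (x : Fin n → 𝒳) :
    vStat φ x = vAvg φ x := by
  rw [vStat, vAvg, Fintype.card_fin]
  congr 1
  exact Finset.sum_congr (by ext; simp) fun i _ => rfl

-- Sorting writes every injective tuple uniquely as an increasing tuple composed with a permutation.
open scoped Classical in
theorem sum_injective_eq_factorial_smul_sum_strictMono {m n : ℕ} {F : (Fin m → Fin n) → E}
    (hF : ∀ (σ : Equiv.Perm (Fin m)) i, F (i ∘ σ) = F i) :
    ∑ i : Fin m → Fin n with Function.Injective i, F i =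
      (m.factorial : ℝ) • ∑ i : Fin m → Fin n with StrictMono i, F i := by
  have h : ∑ q ∈ (Finset.univ.filter fun i : Fin m → Fin n => StrictMono i) ×ˢ
      (Finset.univ : Finset (Equiv.Perm (Fin m))), F q.1 =
      ∑ i : Fin m → Fin n with Function.Injective i, F i := by
    refine Finset.sum_bij (fun q _ => q.1 ∘ q.2) ?_ ?_ ?_ ?_
    · intro q hq
      have hq' := (Finset.mem_filter.1 (Finset.mem_product.1 hq).1).2
      exact Finset.mem_filter.2 ⟨Finset.mem_univ _, hq'.injective.comp q.2.injective⟩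
    · rintro ⟨i, σ⟩ hq ⟨i', σ'⟩ hq' heq
      have hi : StrictMono i := (Finset.mem_filter.1 (Finset.mem_product.1 hq).1).2
      have hi' : StrictMono i' := (Finset.mem_filter.1 (Finset.mem_product.1 hq').1).2
      simp only at heq
      have hr : Set.range i = Set.range i' := by
        rw [← σ.surjective.range_comp i, heq, σ'.surjective.range_comp i']
      obtain rfl : i = i' := (hi.range_inj hi').1 hr
      have : σ = σ' := Equiv.ext fun a => hi.injective (congrFun heq a)
      rw [this]
    · intro f hf
      have hf' : Function.Injective f := (Finset.mem_filter.1 hf).2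
      refine ⟨(f ∘ Tuple.sort f, (Tuple.sort f)⁻¹), ?_, ?_⟩
      · refine Finset.mem_product.2 ⟨Finset.mem_filter.2 ⟨Finset.mem_univ _, ?_⟩, Finset.mem_univ _⟩
        exact (Tuple.monotone_sort f).strictMono_of_injective
          (hf'.comp (Tuple.sort f).injective)
      · funext a
        simp
    · intro q _
      exact (hF q.2 q.1).symm
  rw [← h, Finset.sum_product]
  simp only [Finset.sum_const, Finset.card_univ, Fintype.card_perm, Fintype.card_fin]
  rw [← Finset.smul_sum, Nat.cast_smul_eq_nsmul]

theorem uStat_eq_injAvg {m n : ℕ} {φ : (Fin m → 𝒳) → E}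
    (hφ : ∀ (σ : Equiv.Perm (Fin m)) (x : Fin m → 𝒳), φ (fun j => x (σ j)) = φ x)
    (x : Fin n → 𝒳) : uStat φ x = injAvg φ x := by
  classical
  have h := sum_injective_eq_factorial_smul_sum_strictMono (m := m) (n := n)
    (F := fun i => φ fun j => x (i j)) (fun σ i => hφ σ fun j => x (i j))
  rw [sum_injective_eq_sum_embedding] at h
  rw [uStat, injAvg, h, smul_smul, Fintype.card_embedding_eq, Fintype.card_fin, Fintype.card_fin,
    Nat.descFactorial_eq_factorial_mul_choose]
  congr 1
  have : (m.factorial : ℝ) ≠ 0 := Nat.cast_ne_zero.2 m.factorial_ne_zero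
  rw [Nat.cast_mul, mul_inv, mul_comm (m.factorial : ℝ)⁻¹, inv_mul_cancel_right₀ this]

end Symmetric

/-! ### From conditional means to conditional probabilities -/

section Resampling

variable [MeasurableSpace 𝒳] {Ω : Type*} [MeasurableSpace Ω] {P : Measure Ω}
  {X : ℕ → Ω → 𝒳} {J : (n : ℕ) → Fin n → Ω → Fin n}

theorem measurable_sample (hX : ∀ k, Measurable (X k)) (n : ℕ) : Measurable (sample X n) :=
  measurable_pi_lambda _ fun k => hX k

theorem IsResampling.measureReal_eq (hJ : IsResampling X J P) (n : ℕ) (j : Fin n → Fin n) :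
    P.real {ω | (fun i => J n i ω) = j} = ((n : ℝ) ^ n)⁻¹ := by
  have h := (hJ.indep n).measure_inter_preimage_eq_mul Finset.univ (sets := fun i => {j i})
    fun i _ => measurableSet_singleton _
  have hset : {ω | (fun i => J n i ω) = j} = ⋂ i ∈ Finset.univ, J n i ⁻¹' {j i} := by
    ext ω
    simp [funext_iff]
  have hu : ∀ i, P (J n i ⁻¹' {j i}) = (n : ℝ≥0∞)⁻¹ := fun i => hJ.uniform n i (j i)
  rw [measureReal_def, hset, h, Finset.prod_congr rfl fun i _ => hu i, Finset.prod_const,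
    Finset.card_univ, Fintype.card_fin]
  simp

variable [IsProbabilityMeasure P]

/-- The conditional probability, given the data, of an event that depends on the data and on the
resampling indices. -/
theorem condExp_resampling (hX : ∀ k, Measurable (X k)) (hJ : IsResampling X J P) (n : ℕ)
    {S : (Fin n → Fin n) → Set (Fin n → 𝒳)} (hS : ∀ j, MeasurableSet (S j)) :
    P⟦{ω | sample X n ω ∈ S fun i => J n i ω} | dataSigma X n⟧ =ᵐ[P]
      fun ω => bootAvg fun j => (S j).indicator (fun _ => (1 : ℝ)) (sample X n ω) := by
  have hle : dataSigma X n ≤ ‹MeasurableSpace Ω› := (measurable_sample hX n).comap_le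
  have hJm : Measurable fun ω i => J n i ω := measurable_pi_lambda _ fun i => hJ.measurable n i
  let a : (Fin n → Fin n) → Ω → ℝ := fun j ω => (S j).indicator (fun _ => (1 : ℝ)) (sample X n ω)
  let b : (Fin n → Fin n) → Ω → ℝ := fun j =>
    {ω | (fun i => J n i ω) = j}.indicator fun _ => (1 : ℝ)
  have hbs : ∀ j, MeasurableSet {ω | (fun i => J n i ω) = j} := fun j =>
    hJm (measurableSet_singleton j)
  have ham : ∀ j, StronglyMeasurable[dataSigma X n] (a j) := fun j =>
    ((measurable_const.indicator (hS j)).comp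
      (comap_measurable (sample X n))).stronglyMeasurable
  have hbm : ∀ j, StronglyMeasurable[MeasurableSpace.comap (fun ω i => J n i ω) inferInstance]
      (b j) := fun j =>
    have h : MeasurableSet[MeasurableSpace.comap (fun ω i => J n i ω) inferInstance]
        {ω | (fun i => J n i ω) = j} := ⟨{j}, measurableSet_singleton j, rfl⟩
    (measurable_const.indicator h).stronglyMeasurable
  have hbi : ∀ j, Integrable (b j) P := fun j => (integrable_const _).indicator (hbs j)
  have habi : ∀ j, Integrable (a j * b j) P := fun j => by
    have hb1 : ∀ ω, ‖a j ω‖ ≤ 1 := fun ω => by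
      by_cases h : sample X n ω ∈ S j <;> simp [a, h]
    exact (hbi j).bdd_mul ((ham j).mono hle).aestronglyMeasurable (ae_of_all _ hb1)
  -- Split the event by the value of the index vector: each piece is a data-measurable factor times
  -- a factor independent of the data.
  have hsum : ({ω | sample X n ω ∈ S fun i => J n i ω}.indicator fun _ => (1 : ℝ)) =
      ∑ j : Fin n → Fin n, a j * b j := by
    funext ω
    rw [Finset.sum_apply, Finset.sum_eq_single (fun i => J n i ω)]
    · by_cases h : sample X n ω ∈ S fun i => J n i ω <;> simp [a, b, h]
    · intro j _ hj
      have : ω ∉ {ω | (fun i => J n i ω) = j} := fun h => hj (Eq.symm h)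
      simp only [Pi.mul_apply, b, Set.indicator_of_notMem this, mul_zero]
    · intro h
      exact absurd (Finset.mem_univ _) h
  have hterm : ∀ j, P[a j * b j | dataSigma X n] =ᵐ[P] fun ω => a j ω * ((n : ℝ) ^ n)⁻¹ :=
    fun j => by
      have h1 := condExp_mul_of_stronglyMeasurable_left (ham j) (habi j) (hbi j)
      have h2 := condExp_indep_eq hJm.comap_le hle (hbm j) ((IndepFun_iff_Indep _ _ _).1 (hJ.indep_sample n))
      have h3 : ∫ ω, b j ω ∂P = ((n : ℝ) ^ n)⁻¹ := by
        rw [← hJ.measureReal_eq n j]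
        exact integral_indicator_one (hbs j)
      filter_upwards [h1, h2] with ω hω hω'
      rw [hω, Pi.mul_apply, hω', h3]
  rw [hsum]
  refine (condExp_finsetSum (fun j _ => habi j) _).trans ?_
  filter_upwards [ae_all_iff.2 hterm] with ω hω
  rw [Finset.sum_apply, Finset.sum_congr rfl fun j _ => hω j, bootAvg, Finset.mul_sum]
  exact Finset.sum_congr rfl fun j _ => mul_comm _ _

/-- If the mean of a nonnegative statistic over the bootstrap samples tends to zero almost surely,
then the statistic of the bootstrap sample tends to zero in probability, both conditionally on the
data and unconditionally. -/
theorem tendsto_measure_of_tendsto_bootAvg (hX : ∀ k, Measurable (X k)) (hJ : IsResampling X J P)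
    {D : (n : ℕ) → (Fin n → 𝒳) → ℝ} (hDm : ∀ n, Measurable (D n)) (hD0 : ∀ n x, 0 ≤ D n x)
    (hD : ∀ᵐ ω ∂P, Tendsto (fun n => bootAvg fun j => D n fun k => sample X n ω (j k))
      atTop (𝓝 0)) {ε : ℝ} (hε : 0 < ε) :
    Tendsto (fun n => P {ω | ε < D n (bootSample X J n ω)}) atTop (𝓝 0) ∧
      ∀ᵐ ω ∂P, Tendsto (fun n =>
        (P⟦{ω' | ε < D n (bootSample X J n ω')} | dataSigma X n⟧) ω) atTop (𝓝 0) := by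
  let S : (n : ℕ) → (Fin n → Fin n) → Set (Fin n → 𝒳) := fun n j => {x | ε < D n fun k => x (j k)}
  have hS : ∀ n j, MeasurableSet (S n j) := fun n j =>
    measurableSet_lt measurable_const ((hDm n).comp (by fun_prop))
  have hle : ∀ n, dataSigma X n ≤ ‹MeasurableSpace Ω› := fun n => (measurable_sample hX n).comap_le
  have hev : ∀ n, {ω | ε < D n (bootSample X J n ω)} =
      {ω | sample X n ω ∈ S n fun i => J n i ω} := fun n => rfl
  have hevm : ∀ n, MeasurableSet {ω | ε < D n (bootSample X J n ω)} := fun n => by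
    have : {ω | ε < D n (bootSample X J n ω)} =
        ⋃ j : Fin n → Fin n, {ω | (fun i => J n i ω) = j} ∩ sample X n ⁻¹' S n j := by
      ext ω
      simp only [Set.mem_iUnion, Set.mem_inter_iff]
      exact ⟨fun h => ⟨_, rfl, h⟩, by rintro ⟨j, rfl, h⟩; exact h⟩
    rw [this]
    exact MeasurableSet.iUnion fun j => MeasurableSet.inter
      ((measurable_pi_lambda _ fun i => hJ.measurable n i) (measurableSet_singleton j))
      (measurable_sample hX n (hS n j))
  have hcond : ∀ n, P⟦{ω' | ε < D n (bootSample X J n ω')} | dataSigma X n⟧ =ᵐ[P]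
      fun ω => bootAvg fun j => (S n j).indicator (fun _ => (1 : ℝ)) (sample X n ω) := fun n => by
    rw [hev n]
    exact condExp_resampling hX hJ n (hS n)
  have hind0 : ∀ n j x, 0 ≤ (S n j).indicator (fun _ => (1 : ℝ)) x := fun n j x =>
    Set.indicator_nonneg (fun _ _ => zero_le_one) x
  have hind1 : ∀ n j x, (S n j).indicator (fun _ => (1 : ℝ)) x ≤ 1 := fun n j x =>
    Set.indicator_le_self' (fun _ _ => zero_le_one) x
  have hmarkov : ∀ n j x, (S n j).indicator (fun _ => (1 : ℝ)) x ≤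
      ε⁻¹ * D n fun k => x (j k) := fun n j x => by
    by_cases h : x ∈ S n j
    · rw [Set.indicator_of_mem h, inv_mul_eq_div, one_le_div hε]
      exact le_of_lt h
    · rw [Set.indicator_of_notMem h]
      exact mul_nonneg (by positivity) (hD0 _ _)
  have hae : ∀ᵐ ω ∂P, Tendsto (fun n =>
      (P⟦{ω' | ε < D n (bootSample X J n ω')} | dataSigma X n⟧) ω) atTop (𝓝 0) := by
    filter_upwards [ae_all_iff.2 hcond, hD] with ω hω hlim
    have h := hlim.const_mul ε⁻¹
    rw [mul_zero] at h
    refine squeeze_zero (fun n => ?_) (fun n => ?_) h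
    · rw [hω n]
      exact bootAvg_nonneg fun j => hind0 n j _
    · rw [hω n, ← bootAvg_const_mul]
      exact bootAvg_mono fun j => hmarkov n j _
  refine ⟨?_, hae⟩
  -- The unconditional probability is the integral of the conditional ones, which are dominated by
  -- 1.
  have hlim := tendsto_integral_of_dominated_convergence (μ := P)
    (F := fun n => P⟦{ω' | ε < D n (bootSample X J n ω')} | dataSigma X n⟧) (f := fun _ => (0 : ℝ))
    (fun _ => 1) (fun n => integrable_condExp.aestronglyMeasurable) (integrable_const _)
    (fun n => by
      filter_upwards [hcond n] with ω hω
      rw [hω, Real.norm_of_nonneg (bootAvg_nonneg fun j => hind0 n j _)]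
      exact (bootAvg_mono fun j => hind1 n j _).trans_eq (bootAvg_const 1)) hae
  rw [integral_zero] at hlim
  have h := ENNReal.tendsto_ofReal hlim
  rw [ENNReal.ofReal_zero] at h
  refine h.congr fun n => ?_
  rw [integral_condExp (hle n)]
  have hone : ∫ ω, {ω' | ε < D n (bootSample X J n ω')}.indicator (fun _ => (1 : ℝ)) ω ∂P =
      P.real {ω' | ε < D n (bootSample X J n ω')} := integral_indicator_one (hevm n)
  rw [hone, ofReal_measureReal]

end Resampling

/-! ### Transfer from the sequence space to the observations -/

section Observations

variable [MeasurableSpace 𝒳] {Ω : Type*} [MeasurableSpace Ω] {P : Measure Ω}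
  [IsProbabilityMeasure P] {X : ℕ → Ω → 𝒳} {ι : Type*} [Fintype ι]
  {E : Type*} [NormedAddCommGroup E]

theorem map_eq_seqLaw (hX : ∀ k, Measurable (X k)) (hind : iIndepFun X P)
    (hid : ∀ k, IdentDistrib (X k) (X 0) P P) :
    P.map (fun ω k => X k ω) = Measure.infinitePi fun _ : ℕ => P.map (X 0) := by
  rw [(iIndepFun_iff_map_fun_eq_infinitePi_map hX).1 hind]
  congr 1
  funext k
  exact (hid k).map_eq

theorem measurePreserving_observations (hX : ∀ k, Measurable (X k)) (hind : iIndepFun X P)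
    (hid : ∀ k, IdentDistrib (X k) (X 0) P P) {f : ι → ℕ} (hf : f.Injective) :
    MeasurePreserving (fun ω a => X (f a) ω) P (Measure.pi fun _ : ι => P.map (X 0)) := by
  have := Measure.isProbabilityMeasure_map (μ := P) (hX 0).aemeasurable
  exact (measurePreserving_comp_injective (P.map (X 0)) hf).comp
    ⟨measurable_pi_lambda _ hX, map_eq_seqLaw hX hind hid⟩

theorem ae_observations (hX : ∀ k, Measurable (X k)) (hind : iIndepFun X P)
    (hid : ∀ k, IdentDistrib (X k) (X 0) P P) {p : (ℕ → 𝒳) → Prop}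
    (h : ∀ᵐ x ∂(seqLaw (P.map (X 0))), p x) : ∀ᵐ ω ∂P, p fun k => X k ω := by
  rw [seqLaw, ← map_eq_seqLaw hX hind hid] at h
  exact ae_of_ae_map (measurable_pi_lambda _ hX).aemeasurable h

theorem integrable_of_lintegral_sample_lt_top [MeasurableSpace E] [BorelSpace E]
    [SecondCountableTopology E] (hX : ∀ k, Measurable (X k)) (hind : iIndepFun X P)
    (hid : ∀ k, IdentDistrib (X k) (X 0) P P) {m : ℕ} {φ : (Fin m → 𝒳) → E} (hφ : Measurable φ)
    (h : ∫⁻ ω, ‖φ (sample X m ω)‖ₑ ∂P < ∞) :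
    Integrable φ (Measure.pi fun _ : Fin m => P.map (X 0)) := by
  refine ⟨hφ.aestronglyMeasurable, ?_⟩
  rw [HasFiniteIntegral, ← (measurePreserving_observations hX hind hid
    (f := fun a : Fin m => (a : ℕ)) Fin.val_injective).lintegral_comp hφ.enorm]
  exact h

theorem patternMoment_of_lintegral_lt_top [MeasurableSpace E] [BorelSpace E]
    [SecondCountableTopology E] (hX : ∀ k, Measurable (X k)) (hind : iIndepFun X P)
    (hid : ∀ k, IdentDistrib (X k) (X 0) P P) {m : ℕ} {φ : (Fin m → 𝒳) → E} (hφ : Measurable φ)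
    (h : ∀ i : Fin m → ℕ, ∫⁻ ω, ‖φ (fun j => X (i j) ω)‖ₑ ^
      (((Finset.univ.image i).card : ℝ) / (m : ℝ)) ∂P < ∞) :
    PatternMoment (P.map (X 0)) φ := by
  intro p
  have hm : Measurable fun y : Fin p.1 → 𝒳 => φ fun a => y (p.2.1 a) := hφ.comp (by fun_prop)
  -- The moment condition is used at the pattern itself, read as an index tuple; surjectivity gives
  -- it exactly `d` distinct indices.
  have hcard : (Finset.univ.image fun a => ((p.2.1 a : Fin p.1) : ℕ)).card = p.1 := by
    have : (Finset.univ.image fun a => ((p.2.1 a : Fin p.1) : ℕ)) =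
        (Finset.univ : Finset (Fin p.1)).image Fin.val := by
      rw [← Finset.image_univ_of_surjective p.2.2, Finset.image_image]
      rfl
    rw [this, Finset.card_image_of_injective _ Fin.val_injective, Finset.card_univ,
      Fintype.card_fin]
  refine ⟨(hm.norm.pow_const _).aestronglyMeasurable, ?_⟩
  rw [HasFiniteIntegral, ← (measurePreserving_observations hX hind hid
    (f := fun a : Fin p.1 => (a : ℕ)) Fin.val_injective).lintegral_comp
    (hm.norm.pow_const _).enorm]
  have hp := h fun a => ((p.2.1 a : Fin p.1) : ℕ)
  rw [hcard] at hp
  refine lt_of_eq_of_lt (lintegral_congr fun ω => ?_) hp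
  rw [Real.enorm_rpow_of_nonneg (norm_nonneg _) (by positivity), enorm_norm]
  simp only [Fintype.card_fin]

end Observations

/-! ### Kernels with values in a space of continuous functions -/

section ContinuousKernel

theorem measurable_of_measurable_enorm_sub {α : Type*} [MeasurableSpace α] {E : Type*}
    [NormedAddCommGroup E] [MeasurableSpace E] [BorelSpace E] [SecondCountableTopology E]
    {f : α → E} (hf : ∀ c, Measurable fun a => ‖f a - c‖ₑ) : Measurable f := by
  refine measurable_of_isOpen fun U hU => ?_
  obtain ⟨s, hs, hsd⟩ := TopologicalSpace.exists_countable_dense E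
  -- The index `0` means radius `∞`; it is harmless because the ball must lie in `U`.
  let I : Set (E × ℕ) := {q | q.1 ∈ s ∧ Metric.eball q.1 ((q.2 : ℝ≥0∞)⁻¹) ⊆ U}
  have hI : I.Countable := (hs.prod Set.countable_univ).mono fun q hq => Set.mem_prod.2 ⟨hq.1, Set.mem_univ _⟩
  have hU' : f ⁻¹' U = ⋃ q ∈ I, {a | ‖f a - q.1‖ₑ < (q.2 : ℝ≥0∞)⁻¹} := by
    ext a
    simp only [Set.mem_preimage, Set.mem_iUnion, exists_prop]
    constructor
    · intro ha
      obtain ⟨ε, hε, hball⟩ := EMetric.isOpen_iff.1 hU (f a) ha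
      obtain ⟨k, hk⟩ := ENNReal.exists_inv_nat_lt (ENNReal.half_pos hε.ne').ne'
      have hk0 : (0 : ℝ≥0∞) < (k : ℝ≥0∞)⁻¹ := ENNReal.inv_pos.2 (ENNReal.natCast_ne_top k)
      obtain ⟨c, hc, hcs⟩ := EMetric.mem_closure_iff.1 (hsd (f a)) _ hk0
      refine ⟨(c, k), ⟨hc, fun z hz => hball ?_⟩, ?_⟩
      · calc edist z (f a) ≤ edist z c + edist c (f a) := edist_triangle _ _ _
          _ < ε / 2 + ε / 2 := by
            refine ENNReal.add_lt_add ((Metric.mem_eball.1 hz).trans hk) ?_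
            rw [edist_comm]
            exact hcs.trans hk
          _ = ε := ENNReal.add_halves ε
      · change ‖f a - c‖ₑ < (k : ℝ≥0∞)⁻¹
        rw [← edist_eq_enorm_sub]
        exact hcs
    · rintro ⟨q, hq, ha⟩
      refine hq.2 (Metric.mem_eball.2 ?_)
      rw [edist_eq_enorm_sub]
      exact ha
  rw [hU']
  exact MeasurableSet.biUnion hI fun q _ => measurableSet_lt (hf q.1) measurable_const

variable {K B : Type*} [TopologicalSpace K] [CompactSpace K] [NormedAddCommGroup B]

/-- A kernel depending continuously on a parameter, as a kernel with values in the space of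
continuous functions of the parameter. -/
def paramKernel {m : ℕ} (Φ : K → (Fin m → 𝒳) → B) (hΦ : ∀ x, Continuous fun θ => Φ θ x)
    (y : Fin m → 𝒳) : C(K, B) := ⟨fun θ => Φ θ y, hΦ y⟩

variable {m : ℕ} {Φ : K → (Fin m → 𝒳) → B} {hΦ : ∀ x, Continuous fun θ => Φ θ x}

/-- Distances to fixed functions suffice, and by continuity such a distance is a supremum over a
countable dense set of parameters. -/
theorem measurable_paramKernel [MeasurableSpace 𝒳] [TopologicalSpace.SeparableSpace K]
    [MeasurableSpace B] [BorelSpace B] [SecondCountableTopology B] [MeasurableSpace C(K, B)]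
    [BorelSpace C(K, B)] [SecondCountableTopology C(K, B)] (hm : ∀ θ, Measurable (Φ θ)) :
    Measurable (paramKernel Φ hΦ) := by
  refine measurable_of_measurable_enorm_sub fun c => ?_
  obtain ⟨s, hs, hsd⟩ := TopologicalSpace.exists_countable_dense K
  have : Countable s := hs
  have h : (fun y => ‖paramKernel Φ hΦ y - c‖ₑ) = fun y => ⨆ θ : s, ‖Φ θ y - c θ‖ₑ := by
    funext y
    rw [ContinuousMap.enorm_eq_iSup_enorm,
      ← hsd.ciSup' (paramKernel Φ hΦ y - c).continuous.enorm]
    rfl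
  rw [h]
  exact Measurable.iSup fun θ => ((hm θ).sub_const _).enorm

variable [NormedSpace ℝ B]

theorem injAvg_paramKernel_apply {n : ℕ} (x : Fin n → 𝒳) (θ : K) :
    injAvg (paramKernel Φ hΦ) x θ = injAvg (Φ θ) x := by
  simp [injAvg, paramKernel]

theorem vAvg_paramKernel_apply {n : ℕ} (x : Fin n → 𝒳) (θ : K) :
    vAvg (paramKernel Φ hΦ) x θ = vAvg (Φ θ) x := by
  simp [vAvg, paramKernel]

theorem integral_paramKernel_apply [MeasurableSpace 𝒳] [CompleteSpace B]
    {π : Measure (Fin m → 𝒳)} (hi : Integrable (paramKernel Φ hΦ) π) (θ : K) :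
    (∫ y, paramKernel Φ hΦ y ∂π) θ = ∫ y, Φ θ y ∂π :=
  (ContinuousLinearMap.integral_comp_comm (ContinuousMap.evalCLM ℝ θ) hi).symm

end ContinuousKernel

end UVStat

/-! ### Norm conversions and measurability of the averages -/

namespace UVStat

variable {𝒳 : Type*} {E : Type*} [NormedAddCommGroup E]

theorem ofReal_lt_enorm_iff {ε : ℝ} (hε : 0 < ε) (v : E) :
    ENNReal.ofReal ε < ‖v‖ₑ ↔ ε < ‖v‖ := by
  rw [← ofReal_norm, ENNReal.ofReal_lt_ofReal_iff_of_nonneg hε.le]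

theorem tendsto_enorm_sub_zero {u : ℕ → E} {g : E} (h : Tendsto u atTop (𝓝 g)) :
    Tendsto (fun n => ‖u n - g‖ₑ) atTop (𝓝 0) := by
  simpa [edist_eq_enorm_sub] using tendsto_iff_edist_tendsto_0.1 h

variable [NormedSpace ℝ E]

theorem measurable_vAvg [MeasurableSpace 𝒳] [MeasurableSpace E] [BorelSpace E]
    [SecondCountableTopology E] {ι : Type*} [Fintype ι] {φ : (ι → 𝒳) → E} (hφ : Measurable φ)
    (n : ℕ) : Measurable fun x : Fin n → 𝒳 => vAvg φ x := by
  unfold vAvg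
  exact (Finset.measurable_sum _ fun i _ => hφ.comp (by fun_prop)).const_smul _

theorem measurable_injAvg [MeasurableSpace 𝒳] [MeasurableSpace E] [BorelSpace E]
    [SecondCountableTopology E] {ι : Type*} [Fintype ι] {φ : (ι → 𝒳) → E} (hφ : Measurable φ)
    (n : ℕ) : Measurable fun x : Fin n → 𝒳 => injAvg φ x := by
  unfold injAvg
  exact (Finset.measurable_sum _ fun i _ => hφ.comp (by fun_prop)).const_smul _

end UVStat

/-! ### Assembly with a single kernel in `C(Θ, B)` -/

theorem theoremA
    {Ω : Type*} [MeasurableSpace Ω] (P : Measure Ω) [IsProbabilityMeasure P]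
    {𝒳 : Type*} [MeasurableSpace 𝒳]
    {B : Type*} [NormedAddCommGroup B] [NormedSpace ℝ B] [CompleteSpace B]
    [TopologicalSpace.SeparableSpace B] [MeasurableSpace B] [BorelSpace B]
    {T : Type*} [MetricSpace T] [TopologicalSpace.SeparableSpace T]
    (Θ : Set T) (hΘ : IsCompact Θ)
    -- i.i.d. observations
    (X : ℕ → Ω → 𝒳) (hXmeas : ∀ k, Measurable (X k)) (hXindep : iIndepFun X P)
    (hXident : ∀ k, IdentDistrib (X k) (X 0) P P)
    -- the kernels
    (m : ℕ) (hm : 0 < m) (Φ : Θ → (Fin m → 𝒳) → B)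
    (hΦcont : ∀ x, Continuous (fun θ => Φ θ x))
    (hΦmeas : ∀ θ, Measurable (Φ θ))
    (hΦsymm : ∀ θ (σ : Equiv.Perm (Fin m)) (x : Fin m → 𝒳), Φ θ (fun j => x (σ j)) = Φ θ x) :
    -- (a) U-statistics
    ((∫⁻ ω, ⨆ θ, ‖Φ θ (UVStat.sample X m ω)‖ₑ ∂P < ∞) →
      (∀ θ, Integrable (fun ω => Φ θ (UVStat.sample X m ω)) P) ∧
      ∀ᵐ ω ∂P, Tendsto (fun n =>
        ⨆ θ, ‖UVStat.uStat (Φ θ) (UVStat.sample X n ω) - UVStat.kernelMean Φ X P θ‖ₑ)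
        atTop (𝓝 0)) ∧
    ((∀ i : Fin m → ℕ,
        ∫⁻ ω, ⨆ θ, ‖Φ θ (fun j => X (i j) ω)‖ₑ ^
          (((Finset.univ.image i).card : ℝ) / (m : ℝ)) ∂P < ∞) →
      -- (b) V-statistics
      ((∀ θ, Integrable (fun ω => Φ θ (UVStat.sample X m ω)) P) ∧
        ∀ᵐ ω ∂P, Tendsto (fun n =>
          ⨆ θ, ‖UVStat.vStat (Φ θ) (UVStat.sample X n ω) - UVStat.kernelMean Φ X P θ‖ₑ)
          atTop (𝓝 0)) ∧
      -- (c) bootstrap U-statistics and bootstrap V-statistics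
      (UVStat.IsTypeTwo B → ∀ J : (n : ℕ) → Fin n → Ω → Fin n, UVStat.IsResampling X J P →
        ∀ ε : ℝ, 0 < ε →
        (Tendsto (fun n => P {ω | ENNReal.ofReal ε <
            ⨆ θ, ‖UVStat.uStat (Φ θ) (UVStat.bootSample X J n ω) -
              UVStat.kernelMean Φ X P θ‖ₑ}) atTop (𝓝 0) ∧
          ∀ᵐ ω ∂P, Tendsto (fun n => (P⟦{ω' | ENNReal.ofReal ε <
            ⨆ θ, ‖UVStat.uStat (Φ θ) (UVStat.bootSample X J n ω') -
              UVStat.kernelMean Φ X P θ‖ₑ} | UVStat.dataSigma X n⟧) ω) atTop (𝓝 0)) ∧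
        (Tendsto (fun n => P {ω | ENNReal.ofReal ε <
            ⨆ θ, ‖UVStat.vStat (Φ θ) (UVStat.bootSample X J n ω) -
              UVStat.kernelMean Φ X P θ‖ₑ}) atTop (𝓝 0) ∧
          ∀ᵐ ω ∂P, Tendsto (fun n => (P⟦{ω' | ENNReal.ofReal ε <
            ⨆ θ, ‖UVStat.vStat (Φ θ) (UVStat.bootSample X J n ω') -
              UVStat.kernelMean Φ X P θ‖ₑ} | UVStat.dataSigma X n⟧) ω) atTop (𝓝 0)))) := by
  have : CompactSpace Θ := isCompact_iff_compactSpace.1 hΘ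
  have : SecondCountableTopology B := UniformSpace.secondCountable_of_separable B
  let _ : MeasurableSpace C(Θ, B) := borel _
  have : BorelSpace C(Θ, B) := ⟨rfl⟩
  have : IsProbabilityMeasure (P.map (X 0)) :=
    Measure.isProbabilityMeasure_map (hXmeas 0).aemeasurable
  set π := Measure.pi fun _ : Fin m => P.map (X 0) with hπ
  let Ψ : (Fin m → 𝒳) → C(Θ, B) := UVStat.paramKernel Φ hΦcont
  have hΨ : Measurable Ψ := UVStat.measurable_paramKernel hΦmeas
  have hnorm : ∀ y, ⨆ θ, ‖Φ θ y‖ₑ = ‖Ψ y‖ₑ := fun y => (ContinuousMap.enorm_eq_iSup_enorm (Ψ y)).symm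
  have hmean : ∀ θ, UVStat.kernelMean Φ X P θ = ∫ y, Φ θ y ∂π := fun θ => by
    have hmp := UVStat.measurePreserving_observations hXmeas hXindep hXident
      (f := fun a : Fin m => (a : ℕ)) Fin.val_injective
    rw [hπ, ← hmp.map_eq, integral_map hmp.measurable.aemeasurable
      (hΦmeas θ).aestronglyMeasurable]
    rfl
  have hint : Integrable Ψ π → ∀ θ, Integrable (fun ω => Φ θ (UVStat.sample X m ω)) P :=
    fun hi θ => by
      have hmp := UVStat.measurePreserving_observations hXmeas hXindep hXident
        (f := fun a : Fin m => (a : ℕ)) Fin.val_injective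
      have h1 : Integrable (fun y => Φ θ y) π :=
        (ContinuousMap.evalCLM ℝ θ).integrable_comp hi
      exact hmp.integrable_comp_of_integrable h1
  have hU : Integrable Ψ π → ∀ (n : ℕ) (x : Fin n → 𝒳),
      ⨆ θ, ‖UVStat.uStat (Φ θ) x - UVStat.kernelMean Φ X P θ‖ₑ =
        ‖UVStat.injAvg Ψ x - ∫ y, Ψ y ∂π‖ₑ := fun hi n x => by
    rw [ContinuousMap.enorm_eq_iSup_enorm]
    refine iSup_congr fun θ => ?_
    rw [ContinuousMap.sub_apply, UVStat.integral_paramKernel_apply hi,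
      UVStat.injAvg_paramKernel_apply, UVStat.uStat_eq_injAvg (hΦsymm θ), hmean]
  have hV : Integrable Ψ π → ∀ (n : ℕ) (x : Fin n → 𝒳),
      ⨆ θ, ‖UVStat.vStat (Φ θ) x - UVStat.kernelMean Φ X P θ‖ₑ =
        ‖UVStat.vAvg Ψ x - ∫ y, Ψ y ∂π‖ₑ := fun hi n x => by
    rw [ContinuousMap.enorm_eq_iSup_enorm]
    refine iSup_congr fun θ => ?_
    rw [ContinuousMap.sub_apply, UVStat.integral_paramKernel_apply hi,
      UVStat.vAvg_paramKernel_apply, UVStat.vStat_eq_vAvg, hmean]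
  refine ⟨fun h => ?_, fun h => ?_⟩
  · simp only [hnorm] at h
    have hi : Integrable Ψ π :=
      UVStat.integrable_of_lintegral_sample_lt_top hXmeas hXindep hXident hΨ h
    refine ⟨hint hi, ?_⟩
    simp only [hU hi]
    filter_upwards [UVStat.ae_observations hXmeas hXindep hXident
      (UVStat.strongLaw_of_integrable _ hi)] with ω hω
    exact UVStat.tendsto_enorm_sub_zero hω
  · have hmR : (0 : ℝ) < m := Nat.cast_pos.2 hm
    have h' : ∀ i : Fin m → ℕ, ∫⁻ ω, ‖Ψ (fun j => X (i j) ω)‖ₑ ^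
        (((Finset.univ.image i).card : ℝ) / (m : ℝ)) ∂P < ∞ := fun i => by
      -- A positive exponent makes the power an order isomorphism, so it commutes with the supremum
      -- over `θ`; positivity comes from `0 < m`.
      have hcard : 0 < (Finset.univ.image i).card :=
        Finset.card_pos.2 ((Finset.univ_nonempty_iff.2 ⟨⟨0, hm⟩⟩).image i)
      have hp : 0 < ((Finset.univ.image i).card : ℝ) / (m : ℝ) := by positivity
      refine lt_of_eq_of_lt (lintegral_congr fun ω => ?_) (h i)
      rw [← hnorm]
      exact (ENNReal.orderIsoRpow _ hp).map_iSup _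
    have hi : Integrable Ψ π := by
      refine UVStat.integrable_of_lintegral_sample_lt_top hXmeas hXindep hXident hΨ ?_
      -- The tuple of the first `m` indices has exponent 1, so integrability is a special case of
      -- the moment condition.
      have h1 := h' fun a => (a : ℕ)
      rw [Finset.card_image_of_injective _ Fin.val_injective, Finset.card_univ, Fintype.card_fin,
        div_self hmR.ne'] at h1
      simp only [ENNReal.rpow_one] at h1
      exact h1
    have hpm := UVStat.patternMoment_of_lintegral_lt_top hXmeas hXindep hXident hΨ h'
    have hN := UVStat.ae_observations hXmeas hXindep hXident
      (UVStat.ae_tendsto_nonInjAvg_norm _ hΨ.norm hpm)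
    have hB := UVStat.ae_observations hXmeas hXindep hXident
      (UVStat.bootLaw_of_patternMoment _ hΨ hi hpm)
    refine ⟨⟨hint hi, ?_⟩, fun _ J hJ ε hε => ?_⟩
    · simp only [hV hi]
      filter_upwards [UVStat.ae_observations hXmeas hXindep hXident
        (UVStat.strongLaw_of_integrable _ hi), hN] with ω hω hNω
      exact UVStat.tendsto_enorm_sub_zero (UVStat.tendsto_vAvg_of_tendsto_injAvg
        (squeeze_zero_norm (fun n => UVStat.norm_nonInjAvg_le _ _) hNω) hω)
    · simp only [hU hi, hV hi, UVStat.ofReal_lt_enorm_iff hε]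
      constructor
      · refine UVStat.tendsto_measure_of_tendsto_bootAvg hXmeas hJ
          (D := fun n x => ‖UVStat.injAvg Ψ x - ∫ y, Ψ y ∂π‖)
          (fun n => ((UVStat.measurable_injAvg hΨ n).sub_const _).norm)
          (fun n x => norm_nonneg _) ?_ hε
        filter_upwards [hN, hB] with ω hNω hBω
        exact UVStat.tendsto_bootAvg_norm_injAvg_sub hNω hBω
      · exact UVStat.tendsto_measure_of_tendsto_bootAvg hXmeas hJ
          (D := fun n x => ‖UVStat.vAvg Ψ x - ∫ y, Ψ y ∂π‖)
          (fun n => ((UVStat.measurable_vAvg hΨ n).sub_const _).norm)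
          (fun n x => norm_nonneg _) hB hε
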